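/- Let $\alpha,\beta,x\in\mathbb{C}$. Assume that either $\Re(x)>\Re(\alpha+\beta-1)$, or one of $\alpha,\ \beta,\ \alpha+\beta$ is an even integer. Assume moreover that none of the numbers $\frac{x-2\alpha-\beta+2}{2},\ \frac{x}{2},\ \frac{x-\alpha-2\beta+2}{2}$ is a non-positive integer, so that the Gamma factors in the numerator below are finite (where a Gamma factor in the denominator has a pole, its reciprocal is $0$). Then $$ \frac{\Gamma\left(\frac{x-2\alpha-\beta+2}{2}\right)\Gamma\left(\frac{x}{2}\right)\Gamma\left(\frac{x-\alpha-2\beta+2}{2}\right)} {\Gamma\left(\frac{x-\alpha+2}{2}\right)\Gamma\left(\frac{x-2(\alpha+\beta)+2}{2}\right)\Gamma\left(\frac{x-\beta+2}{2}\right)} =\cfrac{1}{\frac{x+\lambda_0}{2}+\cfrac{\kappa_1}{x+\lambda_1+\cfrac{\kappa_2}{x+\lambda_2+\ddots}}}, $$ where for $m\ge 1$ $$ \kappa_{2m}=\frac{(2m-\alpha-\beta)(2m-\alpha)(2m-\beta)}{4(2m-1)},\qquad \kappa_{2m-1}=\frac{(2m-2+\alpha+\beta)(2m-2+\alpha)(2m-2+\beta)}{4(2m-1)},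 $$ and $\lambda_{2m}=0$ for $m\ge 0$, $\lambda_{2m-1}=2(1-\alpha-\beta)$ for $m\ge 1$. The equality means that the approximants $A_n/B_n$ of the continued fraction (with $A_n,B_n$ given by the usual three-term recurrences) have $B_n\neq 0$ for all large $n$ and converge to the left-hand side; if some $\kappa_m$ vanishes, the continued fraction terminates immediately before the first vanishing $\kappa_m$. -/

import Mathlib

open Filter Topology

noncomputable section

open Classical in
/-- The generalized continued fraction `a 0 / (b 0 + a 1 / (b 1 + a 2 / (b 2 + ⋯)))`.
It stops immediately before the first vanishing partial numerator, if there is one. -/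
def contFrac (a b : ℕ → ℂ) : GenContFract ℂ where
  h := 0
  s := ⟨fun n => if ∀ k ≤ n, a k ≠ 0 then some ⟨a n, b n⟩ else none, by
    intro n hn
    change (if ∀ k ≤ n, a k ≠ 0 then some (GenContFract.Pair.mk (a n) (b n)) else none) = none
      at hn
    change (if ∀ k ≤ n + 1, a k ≠ 0 then
      some (GenContFract.Pair.mk (a (n + 1)) (b (n + 1))) else none) = none
    rw [ite_eq_right_iff] at hn
    rw [if_neg]
    intro h
    exact absurd (hn fun k hk => h k (Nat.le_succ_of_le hk)) (by simp)⟩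

/-- The continued fraction `g` converges to the complex number `v`: its approximants
`Aₙ / Bₙ` (from the usual three-term recurrences) are defined for all large `n` and tend to `v`.
The approximants of a terminating continued fraction are eventually equal to its last one. -/
def ConvergesTo (g : GenContFract ℂ) (v : ℂ) : Prop :=
  (∀ᶠ n in atTop, g.dens n ≠ 0) ∧ Tendsto (fun n => g.convs n) atTop (𝓝 v)

/-- The partial numerators `κ n`, `n ≥ 1`. -/
def kappa (α β : ℂ) (n : ℕ) : ℂ :=
  if Even n then ((n : ℂ) - α - β) * (n - α) * (n - β) / (4 * (n - 1))
  else ((n : ℂ) - 1 + α + β) * (n - 1 + α) * (n - 1 + β) / (4 * n)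

/-- The shifts `lam n`, `n ≥ 0`, in the partial denominators. -/
def lam (α β : ℂ) (n : ℕ) : ℂ :=
  if Even n then 0 else 2 * (1 - α - β)

theorem kappa_two_mul (α β : ℂ) (m : ℕ) :
    kappa α β (2 * m) =
      (2 * m - α - β) * (2 * m - α) * (2 * m - β) / (4 * (2 * m - 1)) := by
  simp [kappa]

theorem kappa_two_mul_sub_one (α β : ℂ) (m : ℕ) (hm : 1 ≤ m) :
    kappa α β (2 * m - 1) =
      (2 * m - 2 + α + β) * (2 * m - 2 + α) * (2 * m - 2 + β) / (4 * (2 * m - 1)) := by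
  have h : ¬ Even (2 * m - 1) := by
    rw [Nat.even_iff]
    omega
  rw [kappa, if_neg h, Nat.cast_sub (by omega)]
  push_cast
  ring_nf

/-- The sequence of partial numerators `1, κ 1, κ 2, …`. -/
def partNum (α β : ℂ) : ℕ → ℂ
  | 0 => 1
  | n + 1 => kappa α β (n + 1)

/-- The sequence of partial denominators `(x + lam 0) / 2, x + lam 1, x + lam 2, …`. -/
def partDen (α β x : ℂ) : ℕ → ℂ
  | 0 => (x + lam α β 0) / 2
  | n + 1 => x + lam α β (n + 1)

end

/-! The numerators `A n` and denominators `B n` solve one three-term recurrence. After division by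
the factorial growth `n! / 2 ^ n`, two consecutive steps form a planar system `u (m + 1) = (1 + T /
(m + 1) + O(1 / m ^ 2)) u m`. Put `c = 1 - α - β` and `x' = x + 2 * c`. The matrix `T` is traceless,
with diagonal entries `±c` and off-diagonal entries `x`, `x'`, and `c ^ 2 + x * x' = (x + c) ^ 2`,
so its eigenvalues are `±z` with `z = x + 1 - α - β`. For `0 < z.re` every solution has a growth
constant relative to `m ^ z`, linear in the solution (`IsSol.exists_hasGrowth`). Hence `A n / B n`
tends to the quotient `lA / lB` of the growth constants as soon as `lB ≠ 0`.

This quotient is found from a functional equation. A Bauer–Muir type transformation carries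
solutions at `x` to solutions at `x + 2` and multiplies growth constants by a known nonzero factor
(`IsSol.shift`, `HasGrowth.shift`). It sends `A` and `B` to explicit multiples of their counterparts
at `x + 2`, and the Gamma quotient `G` obeys the resulting first-order equation. Thus `lB * G / lA`
is constant along `x + 2 * n`. A parabola-theorem argument gives `lB / lA ~ x / 2` for large `x.re`
(`exists_growth_quotient_bound`), and Euler's limit gives `G ~ 2 / x` along `x + 2 * n`, so the
constant is `1`. The functional equation then brings the result back to all `x` with `0 < z.re`.

If some `κ` vanishes, the fraction is a rational function of `x` that equals `G` far to the right.
Multiplied out with the entire function `1 / Γ`, this identity holds for every `x`. -/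

noncomputable section

/-! ### Nearly diagonal difference systems -/

/-- A nonnegative sequence contracted by the factors `1 - θ / (m + 1)`, up to errors of order
`1 / (m + 1) ^ 2`, tends to zero. -/
theorem tendsto_zero_of_le_one_sub_div {a : ℕ → ℝ} {θ S : ℝ} (hθ : 0 < θ) (hS : 0 ≤ S)
    (ha : ∀ m, 0 ≤ a m)
    (h : ∀ m : ℕ, a (m + 1) ≤ (1 - θ / (m + 1)) * a m + S / ((m : ℝ) + 1) ^ 2) :
    Tendsto a atTop (𝓝 0) := by
  -- The bound `t ≤ 1 / 4` gives `4 * t + 1 ≤ 2`, which lets the correction `4 * S / (m + 1)` in `b`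
  -- absorb the error term; `b` is then purely contracted, and the harmonic series diverges.
  obtain ⟨t, ht0, ht4, htθ⟩ : ∃ t : ℝ, 0 < t ∧ t ≤ 1 / 4 ∧ t ≤ θ :=
    ⟨min θ (1 / 4), by positivity, min_le_right _ _, min_le_left _ _⟩
  set b : ℕ → ℝ := fun m => a m + 4 * S / (m + 1) with hb
  have hb0 : ∀ m, 0 ≤ b m := fun m => add_nonneg (ha m) (by positivity)
  have hstep : ∀ m : ℕ, b (m + 1) ≤ (1 - t / (m + 1)) * b m := by
    intro m
    have hm : (0 : ℝ) < (m : ℝ) + 1 := by positivity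
    have h1 := h m
    have h2 : (1 - θ / (m + 1)) * a m ≤ (1 - t / (m + 1)) * a m := by
      apply mul_le_mul_of_nonneg_right _ (ha m)
      have : t / ((m : ℝ) + 1) ≤ θ / (m + 1) := by gcongr
      linarith
    have h3 : S / ((m : ℝ) + 1) ^ 2 + 4 * S / ((m : ℝ) + 1 + 1)
        ≤ (1 - t / (m + 1)) * (4 * S / (m + 1)) := by
      have e : (1 - t / (m + 1)) * (4 * S / (m + 1)) -
          (S / ((m : ℝ) + 1) ^ 2 + 4 * S / ((m : ℝ) + 1 + 1)) =
          S * (4 * (m + 1) - (4 * t + 1) * ((m : ℝ) + 1 + 1)) /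
            (((m : ℝ) + 1) ^ 2 * ((m : ℝ) + 1 + 1)) := by
        field_simp
        ring
      have : 0 ≤ S * (4 * (m + 1) - (4 * t + 1) * ((m : ℝ) + 1 + 1)) /
            (((m : ℝ) + 1) ^ 2 * ((m : ℝ) + 1 + 1)) := by
        apply div_nonneg _ (by positivity)
        apply mul_nonneg hS
        have : (4 * t + 1) * ((m : ℝ) + 1 + 1) ≤ 2 * ((m : ℝ) + 1 + 1) := by
          gcongr; linarith
        have : (0 : ℝ) ≤ m := by positivity
        linarith
      linarith
    simp only [hb]
    push_cast
    linarith
  have hexp : ∀ m : ℕ, b m ≤ b 0 * Real.exp (-(t * ∑ k ∈ Finset.range m, 1 / ((k : ℝ) + 1))) := by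
    intro m
    induction m with
    | zero => simp
    | succ m ih =>
      refine (hstep m).trans ?_
      have e1 : 1 - t / ((m : ℝ) + 1) ≤ Real.exp (-(t * (1 / ((m : ℝ) + 1)))) := by
        have := Real.add_one_le_exp (-(t * (1 / ((m : ℝ) + 1))))
        have e : t * (1 / ((m : ℝ) + 1)) = t / (m + 1) := by ring
        rw [e] at this ⊢
        linarith
      rw [Finset.sum_range_succ, mul_add t, neg_add, Real.exp_add]
      calc (1 - t / ((m : ℝ) + 1)) * b m ≤ Real.exp (-(t * (1 / ((m : ℝ) + 1)))) * b m :=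
            mul_le_mul_of_nonneg_right e1 (hb0 m)
        _ ≤ Real.exp (-(t * (1 / ((m : ℝ) + 1)))) *
            (b 0 * Real.exp (-(t * ∑ k ∈ Finset.range m, 1 / ((k : ℝ) + 1)))) := by gcongr
        _ = _ := by ring
  have hlim : Tendsto (fun m : ℕ =>
      b 0 * Real.exp (-(t * ∑ k ∈ Finset.range m, 1 / ((k : ℝ) + 1)))) atTop (𝓝 0) := by
    have h1 : Tendsto (fun m : ℕ => t * ∑ k ∈ Finset.range m, 1 / ((k : ℝ) + 1)) atTop atTop :=
      Tendsto.const_mul_atTop ht0 Real.tendsto_sum_range_one_div_nat_succ_atTop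
    have h2 := (Real.tendsto_exp_neg_atTop_nhds_zero.comp h1).const_mul (b 0)
    simpa using h2
  refine squeeze_zero ha (fun m => ?_) hlim
  refine le_trans ?_ (hexp m)
  have : 0 ≤ 4 * S / ((m : ℝ) + 1) := by positivity
  simp only [hb]
  linarith

/-- Asymptotics of a two-dimensional linear difference system in diagonal form, perturbed by
terms of order `1 / (m + 1) ^ 2`. -/
theorem exists_limit_of_perturbed_diagonal {P Q : ℕ → ℂ} {K θ : ℝ} (hK : 0 ≤ K) (hθ : 0 < θ)
    (hP : ∀ m : ℕ, ‖P (m + 1) - P m‖ ≤ K / ((m : ℝ) + 1) ^ 2 * (‖P m‖ + ‖Q m‖))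
    (hQ : ∀ m : ℕ, ‖Q (m + 1)‖ ≤
      (1 - θ / (m + 1)) * ‖Q m‖ + K / ((m : ℝ) + 1) ^ 2 * (‖P m‖ + ‖Q m‖)) :
    ∃ l : ℂ, Tendsto P atTop (𝓝 l) ∧ Tendsto Q atTop (𝓝 0) ∧
      ∃ C : ℝ, ∀ m : ℕ, ‖P m - l‖ ≤ C / (m + 1) * (‖P m‖ + ‖Q m‖) := by
  set M : ℕ → ℝ := fun m => ‖P m‖ + ‖Q m‖ with hM
  have hM0 : ∀ m, 0 ≤ M m := fun m => by positivity
  have htel : ∀ m : ℕ, 1 / ((m : ℝ) + 1) ^ 2 ≤ 2 * (1 / ((m : ℝ) + 1) - 1 / ((m : ℝ) + 1 + 1)) := by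
    intro m
    have e : 2 * (1 / ((m : ℝ) + 1) - 1 / ((m : ℝ) + 1 + 1)) - 1 / ((m : ℝ) + 1) ^ 2 =
        m / (((m : ℝ) + 1) ^ 2 * ((m : ℝ) + 1 + 1)) := by
      field_simp
      ring
    have : (0 : ℝ) ≤ m / (((m : ℝ) + 1) ^ 2 * ((m : ℝ) + 1 + 1)) := by positivity
    linarith
  have hKtel : ∀ m : ℕ, K / ((m : ℝ) + 1) ^ 2 ≤
      2 * K * (1 / ((m : ℝ) + 1) - 1 / ((m : ℝ) + 1 + 1)) := by
    intro m
    calc K / ((m : ℝ) + 1) ^ 2 = K * (1 / ((m : ℝ) + 1) ^ 2) := by ring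
      _ ≤ K * (2 * (1 / ((m : ℝ) + 1) - 1 / ((m : ℝ) + 1 + 1))) := by gcongr; exact htel m
      _ = _ := by ring
  have hMstep : ∀ m : ℕ, M (m + 1) ≤ (1 + 2 * (K / ((m : ℝ) + 1) ^ 2)) * M m := by
    intro m
    have h1 : ‖P (m + 1)‖ ≤ ‖P m‖ + ‖P (m + 1) - P m‖ := by
      simpa using norm_add_le (P m) (P (m + 1) - P m)
    have h2 := hP m
    have h3 := hQ m
    have h4 : (1 - θ / ((m : ℝ) + 1)) * ‖Q m‖ ≤ ‖Q m‖ := by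
      have : 0 ≤ θ / ((m : ℝ) + 1) * ‖Q m‖ := by positivity
      linarith
    simp only [hM]
    linarith
  -- Comparing from an arbitrary `m`, not only from `0`, keeps all bounds proportional to `M m`.
  -- This is what makes the final error estimate relative.
  have hMexp : ∀ m k : ℕ, M (m + k) ≤
      M m * Real.exp (4 * K * (1 / ((m : ℝ) + 1) - 1 / ((m : ℝ) + k + 1))) := by
    intro m k
    induction k with
    | zero => simp
    | succ k ih =>
      rw [← add_assoc]
      refine (hMstep (m + k)).trans ?_
      have h1 := hKtel (m + k)
      push_cast at h1 ⊢
      have h2 : 1 + 2 * (K / ((m : ℝ) + k + 1) ^ 2) ≤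
          Real.exp (4 * K * (1 / ((m : ℝ) + k + 1) - 1 / ((m : ℝ) + k + 1 + 1))) := by
        have := Real.add_one_le_exp
          (4 * K * (1 / ((m : ℝ) + k + 1) - 1 / ((m : ℝ) + k + 1 + 1)))
        linarith
      calc (1 + 2 * (K / ((m : ℝ) + k + 1) ^ 2)) * M (m + k)
          ≤ Real.exp (4 * K * (1 / ((m : ℝ) + k + 1) - 1 / ((m : ℝ) + k + 1 + 1))) *
            (M m * Real.exp (4 * K * (1 / ((m : ℝ) + 1) - 1 / ((m : ℝ) + k + 1)))) := by
            gcongr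
        _ = M m * (Real.exp (4 * K * (1 / ((m : ℝ) + 1) - 1 / ((m : ℝ) + k + 1))) *
            Real.exp (4 * K * (1 / ((m : ℝ) + k + 1) - 1 / ((m : ℝ) + k + 1 + 1)))) := by ring
        _ = _ := by
          rw [← Real.exp_add]
          congr 2
          ring_nf
  set e4 : ℝ := Real.exp (4 * K) with he4
  have hMbd : ∀ m k : ℕ, M (m + k) ≤ e4 * M m := by
    intro m k
    refine (hMexp m k).trans ?_
    rw [mul_comm]
    apply mul_le_mul_of_nonneg_right _ (hM0 m)
    apply Real.exp_le_exp.mpr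
    have h1 : 1 / ((m : ℝ) + 1) ≤ 1 := by
      rw [div_le_one (by positivity)]
      linarith [(Nat.cast_nonneg m : (0 : ℝ) ≤ m)]
    have h2 : 0 ≤ 1 / ((m : ℝ) + k + 1) := by positivity
    nlinarith
  have hPdiff : ∀ m k : ℕ, ‖P (m + k) - P m‖ ≤
      2 * K * e4 * M m * (1 / ((m : ℝ) + 1) - 1 / ((m : ℝ) + k + 1)) := by
    intro m k
    induction k with
    | zero => simp
    | succ k ih =>
      have h0 : ‖P (m + k + 1) - P m‖ ≤ ‖P (m + k + 1) - P (m + k)‖ + ‖P (m + k) - P m‖ := by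
        simpa using norm_add_le (P (m + k + 1) - P (m + k)) (P (m + k) - P m)
      have h1 := hKtel (m + k)
      have h2 := hP (m + k)
      push_cast at h1 h2 ⊢
      rw [← add_assoc]
      have h3 : K / ((m : ℝ) + k + 1) ^ 2 * (‖P (m + k)‖ + ‖Q (m + k)‖) ≤
          2 * K * (1 / ((m : ℝ) + k + 1) - 1 / ((m : ℝ) + k + 1 + 1)) * (e4 * M m) :=
        mul_le_mul h1 (hMbd m k) (hM0 _) (le_trans (by positivity) h1)
      calc _ ≤ _ := h0
        _ ≤ 2 * K * (1 / ((m : ℝ) + k + 1) - 1 / ((m : ℝ) + k + 1 + 1)) * (e4 * M m) +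
            2 * K * e4 * M m * (1 / ((m : ℝ) + 1) - 1 / ((m : ℝ) + k + 1)) :=
          add_le_add (h2.trans h3) ih
        _ = _ := by ring_nf
  have hPbd : ∀ m k : ℕ, ‖P (m + k) - P m‖ ≤ 2 * K * e4 / (m + 1) * M m := by
    intro m k
    refine (hPdiff m k).trans ?_
    have h2 : 0 ≤ 1 / ((m : ℝ) + k + 1) := by positivity
    have h3 : 0 ≤ 2 * K * e4 * M m := mul_nonneg (by positivity) (hM0 m)
    calc _ ≤ 2 * K * e4 * M m * (1 / ((m : ℝ) + 1)) := by gcongr; linarith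
      _ = _ := by ring
  have hM1 : ∀ m, M m ≤ e4 * M 0 := fun m => by simpa using hMbd 0 m
  have hcauchy : CauchySeq P := by
    refine cauchySeq_of_le_tendsto_0' (fun m : ℕ => 2 * K * e4 * (e4 * M 0) * (1 / ((m : ℝ) + 1)))
      ?_ ?_
    · intro n m hnm
      obtain ⟨k, rfl⟩ := Nat.exists_eq_add_of_le hnm
      rw [dist_comm, dist_eq_norm]
      refine (hPbd n k).trans ?_
      calc 2 * K * e4 / (n + 1) * M n ≤ 2 * K * e4 / (n + 1) * (e4 * M 0) := by
            gcongr
            exact hM1 n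
        _ = _ := by ring
    · have := tendsto_one_div_add_atTop_nhds_zero_nat (𝕜 := ℝ)
      simpa using this.const_mul (2 * K * e4 * (e4 * M 0))
  obtain ⟨l, hl⟩ := cauchySeq_tendsto_of_complete hcauchy
  refine ⟨l, hl, ?_, 2 * K * e4, fun m => ?_⟩
  · rw [tendsto_zero_iff_norm_tendsto_zero]
    refine tendsto_zero_of_le_one_sub_div hθ (S := K * (e4 * M 0)) ?_ (fun m => norm_nonneg _) ?_
    · exact mul_nonneg hK ((hM0 0).trans (hM1 0))
    · intro m
      refine (hQ m).trans ?_
      have : K / ((m : ℝ) + 1) ^ 2 * (‖P m‖ + ‖Q m‖) ≤ K / ((m : ℝ) + 1) ^ 2 * (e4 * M 0) := by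
        gcongr
        exact hM1 m
      calc _ ≤ (1 - θ / (m + 1)) * ‖Q m‖ + K / ((m : ℝ) + 1) ^ 2 * (e4 * M 0) := by gcongr
        _ = _ := by ring
  · have h1 : Tendsto (fun k => ‖P (m + k) - P m‖) atTop (𝓝 ‖l - P m‖) := by
      refine Tendsto.norm (Tendsto.sub_const ?_ _)
      simpa [add_comm] using (tendsto_add_atTop_iff_nat m).2 hl
    rw [norm_sub_rev]
    exact le_of_tendsto' h1 (hPbd m)

theorem tendsto_atTop_of_even_odd {X : Type*} {f : ℕ → X} {l : Filter X}
    (he : Tendsto (fun m => f (2 * m)) atTop l) (ho : Tendsto (fun m => f (2 * m + 1)) atTop l) :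
    Tendsto f atTop l := by
  intro s hs
  obtain ⟨a, ha⟩ := mem_atTop_sets.1 (he hs)
  obtain ⟨b, hb⟩ := mem_atTop_sets.1 (ho hs)
  refine mem_atTop_sets.2 ⟨2 * (a + b) + 1, fun n hn => ?_⟩
  rcases Nat.even_or_odd' n with ⟨k, rfl | rfl⟩
  · exact ha k (by omega)
  · exact hb k (by omega)

/-! ### The recurrence and its normalized two-step form -/

/-- `y` solves the three-term recurrence of the continued fraction, from index `2` on. -/
def IsSol (α β x : ℂ) (y : ℕ → ℂ) : Prop :=
  ∀ n, y (n + 2) = (x + lam α β (n + 1)) * y (n + 1) + kappa α β (n + 1) * y n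

theorem lam_odd (α β : ℂ) (m : ℕ) : lam α β (2 * m + 1) = 2 * (1 - α - β) := by
  simp [lam]

theorem lam_even (α β : ℂ) (m : ℕ) : lam α β (2 * m) = 0 := by
  simp [lam]

theorem kappa_odd (α β : ℂ) (m : ℕ) : kappa α β (2 * m + 1) =
    (2 * m + α + β) * (2 * m + α) * (2 * m + β) / (4 * (2 * m + 1)) := by
  simp [kappa]

theorem IsSol.even {α β x : ℂ} {y : ℕ → ℂ} (hy : IsSol α β x y) (m : ℕ) :
    y (2 * m + 2) = (x + 2 * (1 - α - β)) * y (2 * m + 1) +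
      (2 * m + α + β) * (2 * m + α) * (2 * m + β) / (4 * (2 * m + 1)) * y (2 * m) := by
  rw [hy, lam_odd, kappa_odd]

theorem IsSol.odd {α β x : ℂ} {y : ℕ → ℂ} (hy : IsSol α β x y) (m : ℕ) :
    y (2 * m + 3) = x * y (2 * m + 2) + (2 * m + 2 - α - β) * (2 * m + 2 - α) *
      (2 * m + 2 - β) / (4 * (2 * m + 1)) * y (2 * m + 1) := by
  have h := kappa_two_mul α β (m + 1)
  have h' := lam_even α β (m + 1)
  rw [show 2 * (m + 1) = 2 * m + 1 + 1 by ring] at h h'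
  rw [hy (2 * m + 1), h, h']
  push_cast
  ring_nf

theorem IsSol.add {α β x : ℂ} {y y' : ℕ → ℂ} (hy : IsSol α β x y) (hy' : IsSol α β x y') :
    IsSol α β x (fun n => y n + y' n) := fun n => by
  simp only [hy n, hy' n]
  ring

theorem IsSol.const_mul {α β x : ℂ} {y : ℕ → ℂ} (c : ℂ) (hy : IsSol α β x y) :
    IsSol α β x (fun n => c * y n) := fun n => by
  simp only [hy n]
  ring

theorem IsSol.ext {α β x : ℂ} {y y' : ℕ → ℂ} (hy : IsSol α β x y) (hy' : IsSol α β x y')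
    (h0 : y 0 = y' 0) (h1 : y 1 = y' 1) (n : ℕ) : y n = y' n := by
  induction n using Nat.twoStepInduction with
  | zero => exact h0
  | one => exact h1
  | more n ih ih' => rw [hy n, hy' n, ih, ih']

/-- Normalization of a solution by its factorial growth. -/
def normalized (y : ℕ → ℂ) (n : ℕ) : ℂ := y (n + 1) * 2 ^ n / n.factorial

theorem IsSol.normalized_even {α β x : ℂ} {y : ℕ → ℂ} (hy : IsSol α β x y) (m : ℕ) :
    normalized y (2 * (m + 1)) = x / (m + 1) * normalized y (2 * m + 1) +
      (2 * (m + 1) - (α + β)) * (2 * (m + 1) - α) * (2 * (m + 1) - β) /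
        ((2 * (m + 1) - 1) ^ 2 * (2 * (m + 1))) * normalized y (2 * m) := by
  have h1 : (m : ℂ) + 1 ≠ 0 := by exact_mod_cast Nat.succ_ne_zero m
  have h2 : (2 * m : ℂ) + 1 ≠ 0 := by exact_mod_cast Nat.succ_ne_zero (2 * m)
  have h3 : ((2 * m).factorial : ℂ) ≠ 0 := by exact_mod_cast Nat.factorial_ne_zero _
  simp only [normalized, show 2 * (m + 1) = 2 * m + 1 + 1 by ring, Nat.factorial_succ]
  rw [hy.odd m, show 2 * m + 1 + 1 = 2 * m + 2 by ring]
  have h4 : 2 * ((m : ℂ) + 1) - 1 = 2 * m + 1 := by ring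
  rw [h4]
  push_cast
  have h5 : (2 * m : ℂ) + 2 = 2 * (m + 1) := by ring
  rw [h5]
  field_simp
  ring

theorem IsSol.normalized_odd {α β x : ℂ} {y : ℕ → ℂ} (hy : IsSol α β x y) (m : ℕ) :
    normalized y (2 * (m + 1) + 1) =
      2 * (x + 2 * (1 - α - β)) / (2 * (m + 1) + 1) * normalized y (2 * (m + 1)) +
      (2 * (m + 1) + (α + β)) * (2 * (m + 1) + α) * (2 * (m + 1) + β) /
        ((2 * (m + 1) + 1) ^ 2 * (2 * (m + 1))) * normalized y (2 * m + 1) := by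
  have h1 : (m : ℂ) + 1 ≠ 0 := by exact_mod_cast Nat.succ_ne_zero m
  have h2 : 2 * ((m : ℂ) + 1) + 1 ≠ 0 := by exact_mod_cast Nat.succ_ne_zero (2 * (m + 1))
  have h3 : ((2 * m + 1).factorial : ℂ) ≠ 0 := by exact_mod_cast Nat.factorial_ne_zero _
  have h := hy.even (m + 1)
  simp only [normalized, show 2 * (m + 1) = 2 * m + 1 + 1 by ring, Nat.factorial_succ] at h h3 ⊢
  rw [h]
  push_cast at h3 ⊢
  have h5 : (2 * m : ℂ) + 1 + 1 = 2 * (m + 1) := by ring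
  rw [h5]
  have h6 : (2 * m : ℂ) + 1 ≠ 0 := by exact_mod_cast Nat.succ_ne_zero (2 * m)
  have h7 : ((2 * m).factorial : ℂ) ≠ 0 := by exact_mod_cast Nat.factorial_ne_zero _
  field_simp
  ring

theorem norm_natCast_add_one (m : ℕ) : ‖(m : ℂ) + 1‖ = m + 1 := by
  rw [← Nat.cast_add_one, Complex.norm_natCast, Nat.cast_add_one]

theorem norm_linear_div_le (a b : ℂ) (m : ℕ) {d : ℂ} (hd : ((m : ℝ) + 1) ^ 3 ≤ ‖d‖) :
    ‖(a * (m + 1) + b) / d‖ ≤ (‖a‖ + ‖b‖) / ((m : ℝ) + 1) ^ 2 := by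
  have hm : (0 : ℝ) < (m : ℝ) + 1 := by positivity
  rw [norm_div]
  calc ‖a * (m + 1) + b‖ / ‖d‖ ≤ (‖a‖ + ‖b‖) * (m + 1) / ((m : ℝ) + 1) ^ 3 := by
        gcongr
        refine (norm_add_le _ _).trans ?_
        rw [norm_mul, norm_natCast_add_one]
        have : ‖b‖ * 1 ≤ ‖b‖ * ((m : ℝ) + 1) := by
          gcongr
          linarith [(Nat.cast_nonneg m : (0 : ℝ) ≤ m)]
        linarith
    _ = _ := by field_simp

/-- Over the common cubic denominator the error has a numerator linear in `m + 1`; `K` is the sum of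
the norms of its two coefficients. -/
theorem exists_norm_even_coeff_sub_le (a b c : ℂ) : ∃ K : ℝ, 0 ≤ K ∧ ∀ m : ℕ,
    ‖(2 * ((m : ℂ) + 1) - a) * (2 * (m + 1) - b) * (2 * (m + 1) - c) /
      ((2 * (m + 1) - 1) ^ 2 * (2 * (m + 1))) - 1 - (1 - (a + b + c) / 2) / (m + 1)‖ ≤
      K / ((m : ℝ) + 1) ^ 2 := by
  refine ⟨‖2 * (a * b + a * c + b * c) + 6 - 4 * (a + b + c)‖ + ‖a + b + c - a * b * c - 2‖,
    by positivity, fun m => ?_⟩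
  have h1 : (m : ℂ) + 1 ≠ 0 := by exact_mod_cast Nat.succ_ne_zero m
  have h2 : 2 * ((m : ℂ) + 1) - 1 ≠ 0 := by
    have : (2 * m : ℂ) + 1 ≠ 0 := by exact_mod_cast Nat.succ_ne_zero (2 * m)
    convert this using 1
    ring
  have hd : ((m : ℝ) + 1) ^ 3 ≤ ‖(2 * ((m : ℂ) + 1) - 1) ^ 2 * (2 * (m + 1))‖ := by
    rw [norm_mul, norm_pow, norm_mul, norm_natCast_add_one,
      show 2 * ((m : ℂ) + 1) - 1 = ((2 * m : ℕ) : ℂ) + 1 by push_cast; ring, norm_natCast_add_one,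
      Complex.norm_ofNat]
    push_cast
    rw [pow_succ]
    have : (0 : ℝ) ≤ m := by positivity
    gcongr <;> linarith
  refine le_trans (le_of_eq ?_) (norm_linear_div_le _ _ m hd)
  congr 1
  field_simp
  ring

theorem exists_norm_odd_coeff_sub_le (a b c : ℂ) : ∃ K : ℝ, 0 ≤ K ∧ ∀ m : ℕ,
    ‖(2 * ((m : ℂ) + 1) + a) * (2 * (m + 1) + b) * (2 * (m + 1) + c) /
      ((2 * (m + 1) + 1) ^ 2 * (2 * (m + 1))) - 1 + (1 - (a + b + c) / 2) / (m + 1)‖ ≤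
      K / ((m : ℝ) + 1) ^ 2 := by
  refine ⟨‖2 * (a * b + a * c + b * c) + 6 - 4 * (a + b + c)‖ + ‖a * b * c + 2 - (a + b + c)‖,
    by positivity, fun m => ?_⟩
  have h1 : (m : ℂ) + 1 ≠ 0 := by exact_mod_cast Nat.succ_ne_zero m
  have h2 : 2 * ((m : ℂ) + 1) + 1 ≠ 0 := by exact_mod_cast Nat.succ_ne_zero (2 * (m + 1))
  have hd : ((m : ℝ) + 1) ^ 3 ≤ ‖(2 * ((m : ℂ) + 1) + 1) ^ 2 * (2 * (m + 1))‖ := by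
    rw [norm_mul, norm_pow, norm_mul, norm_natCast_add_one,
      show 2 * ((m : ℂ) + 1) + 1 = ((2 * (m + 1) : ℕ) : ℂ) + 1 by push_cast; ring,
      norm_natCast_add_one, Complex.norm_ofNat]
    push_cast
    rw [pow_succ]
    have : (0 : ℝ) ≤ m := by positivity
    gcongr <;> linarith
  refine le_trans (le_of_eq ?_) (norm_linear_div_le _ _ m hd)
  congr 1
  field_simp
  ring

/-- The planar system behind the growth rates. `K` is independent of both `y` and `m`. -/
theorem IsSol.exists_norm_normalized_sub_le (α β x : ℂ) : ∃ K : ℝ, 0 ≤ K ∧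
    ∀ y, IsSol α β x y → ∀ m : ℕ,
      ‖normalized y (2 * (m + 1)) - normalized y (2 * m) -
        (x * normalized y (2 * m + 1) + (1 - α - β) * normalized y (2 * m)) / (m + 1)‖ ≤
          K / ((m : ℝ) + 1) ^ 2 * (‖normalized y (2 * m + 1)‖ + ‖normalized y (2 * m)‖) ∧
      ‖normalized y (2 * (m + 1) + 1) - normalized y (2 * m + 1) -
        ((x + 2 * (1 - α - β)) * normalized y (2 * m) -
          (1 - α - β) * normalized y (2 * m + 1)) / (m + 1)‖ ≤
          K / ((m : ℝ) + 1) ^ 2 * (‖normalized y (2 * m + 1)‖ + ‖normalized y (2 * m)‖) := by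
  obtain ⟨K₁, hK₁, h₁⟩ := exists_norm_even_coeff_sub_le (α + β) α β
  obtain ⟨K₂, hK₂, h₂⟩ := exists_norm_odd_coeff_sub_le (α + β) α β
  set c := 1 - α - β with hc
  set x' := x + 2 * c with hx'
  refine ⟨K₁ + K₂ + ‖x'‖ + ‖x'‖ * (‖x‖ + ‖c‖ + K₁), by positivity, fun y hy m => ?_⟩
  have e₁ := hy.normalized_even m
  have e₂ := hy.normalized_odd m
  have b₁ := h₁ m
  have b₂ := h₂ m
  have hcc : 1 - (α + β + α + β) / 2 = c := by rw [hc]; ring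
  rw [hcc] at b₁ b₂
  set v := normalized y (2 * m + 1)
  set w := normalized y (2 * m)
  set w' := normalized y (2 * (m + 1))
  set v' := normalized y (2 * (m + 1) + 1)
  set s : ℂ := (m : ℂ) + 1 with hs
  set t : ℝ := (m : ℝ) + 1 with ht
  have hs0 : s ≠ 0 := by rw [hs]; exact_mod_cast Nat.succ_ne_zero m
  have hs1 : 2 * s + 1 ≠ 0 := by rw [hs]; exact_mod_cast Nat.succ_ne_zero (2 * (m + 1))
  have hst : ‖s‖ = t := norm_natCast_add_one m
  have ht1 : 1 ≤ t := by rw [ht]; linarith [(Nat.cast_nonneg m : (0 : ℝ) ≤ m)]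
  have ht0 : 0 < t := by linarith
  have hst1 : ‖2 * s + 1‖ = 2 * t + 1 := by
    rw [show 2 * s + 1 = ((2 * (m + 1) : ℕ) : ℂ) + 1 by rw [hs]; push_cast; ring,
      norm_natCast_add_one, ht]
    push_cast
    ring
  set A := (2 * s - (α + β)) * (2 * s - α) * (2 * s - β) / ((2 * s - 1) ^ 2 * (2 * s))
  set B := (2 * s + (α + β)) * (2 * s + α) * (2 * s + β) / ((2 * s + 1) ^ 2 * (2 * s))
  have hW : w' - w - (x * v + c * w) / s = (A - 1 - c / s) * w := by
    rw [e₁]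
    field_simp
    ring
  have hW' : ‖w' - w - (x * v + c * w) / s‖ ≤ K₁ / t ^ 2 * (‖v‖ + ‖w‖) := by
    rw [hW, norm_mul]
    gcongr
    linarith [norm_nonneg v]
  have hD : ‖w' - w‖ ≤ (‖x‖ + ‖c‖ + K₁) / t * (‖v‖ + ‖w‖) := by
    have i1 : ‖(x * v + c * w) / s‖ ≤ (‖x‖ + ‖c‖) / t * (‖v‖ + ‖w‖) := by
      rw [norm_div, hst, div_mul_eq_mul_div]
      gcongr
      refine (norm_add_le _ _).trans ?_
      rw [norm_mul, norm_mul, add_mul]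
      gcongr <;> linarith [norm_nonneg v, norm_nonneg w]
    have i2 : K₁ / t ^ 2 * (‖v‖ + ‖w‖) ≤ K₁ / t * (‖v‖ + ‖w‖) := by
      gcongr
      nlinarith
    calc ‖w' - w‖ = ‖(w' - w - (x * v + c * w) / s) + (x * v + c * w) / s‖ := by ring_nf
      _ ≤ _ := norm_add_le _ _
      _ ≤ K₁ / t * (‖v‖ + ‖w‖) + (‖x‖ + ‖c‖) / t * (‖v‖ + ‖w‖) :=
        add_le_add (hW'.trans i2) i1
      _ = _ := by ring
  -- The odd step uses the updated even term `w'`. Replacing `2 / (2 * s + 1)` by `1 / s` and `w'`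
  -- by `w` costs the last two terms, both of second order, the latter by `hD`.
  have hV : v' - v - (x' * w - c * v) / s =
      (B - 1 + c / s) * v - x' / (s * (2 * s + 1)) * w + 2 * x' / (2 * s + 1) * (w' - w) := by
    rw [e₂]
    field_simp
    ring
  have hV1 : ‖(B - 1 + c / s) * v‖ ≤ K₂ / t ^ 2 * (‖v‖ + ‖w‖) := by
    rw [norm_mul]
    gcongr
    linarith [norm_nonneg w]
  have hV2 : ‖x' / (s * (2 * s + 1)) * w‖ ≤ ‖x'‖ / t ^ 2 * (‖v‖ + ‖w‖) := by
    rw [norm_mul, norm_div, norm_mul, hst, hst1]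
    gcongr
    · nlinarith
    · linarith [norm_nonneg v]
  have hV3 : ‖2 * x' / (2 * s + 1) * (w' - w)‖ ≤
      ‖x'‖ * (‖x‖ + ‖c‖ + K₁) / t ^ 2 * (‖v‖ + ‖w‖) := by
    rw [norm_mul, norm_div, norm_mul, hst1, Complex.norm_ofNat]
    calc 2 * ‖x'‖ / (2 * t + 1) * ‖w' - w‖
        ≤ 2 * ‖x'‖ / (2 * t) * ((‖x‖ + ‖c‖ + K₁) / t * (‖v‖ + ‖w‖)) := by
          gcongr
          linarith
      _ = _ := by field_simp
  have hvw : 0 ≤ (‖v‖ + ‖w‖) / t ^ 2 := by positivity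
  refine ⟨hW'.trans ?_, ?_⟩
  · gcongr
    have : 0 ≤ ‖x'‖ * (‖x‖ + ‖c‖ + K₁) := by positivity
    linarith [norm_nonneg x']
  · rw [hV]
    refine (norm_add_le _ _).trans ?_
    have := norm_sub_le ((B - 1 + c / s) * v) (x' / (s * (2 * s + 1)) * w)
    have hk : 0 ≤ K₁ / t ^ 2 * (‖v‖ + ‖w‖) := by positivity
    have e : (K₁ + K₂ + ‖x'‖ + ‖x'‖ * (‖x‖ + ‖c‖ + K₁)) / t ^ 2 * (‖v‖ + ‖w‖) =
      K₁ / t ^ 2 * (‖v‖ + ‖w‖) + K₂ / t ^ 2 * (‖v‖ + ‖w‖) + ‖x'‖ / t ^ 2 * (‖v‖ + ‖w‖) +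
        ‖x'‖ * (‖x‖ + ‖c‖ + K₁) / t ^ 2 * (‖v‖ + ‖w‖) := by ring
    rw [e]
    linarith

/-! ### Growth constants of solutions -/

/-- The product `∏ (1 + z / (k + 1))`, of order `m ^ z`. -/
def growth (z : ℂ) (m : ℕ) : ℂ := ∏ k ∈ Finset.range m, (1 + z / (k + 1))

theorem growth_succ (z : ℂ) (m : ℕ) : growth z (m + 1) = growth z m * (1 + z / (m + 1)) :=
  Finset.prod_range_succ _ _

theorem one_le_norm_one_add_div {z : ℂ} (hz : 0 < z.re) (m : ℕ) : 1 ≤ ‖1 + z / ((m : ℂ) + 1)‖ := by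
  have h : (1 + z / ((m : ℂ) + 1)).re = 1 + z.re / (m + 1) := by
    rw [show (m : ℂ) + 1 = (((m : ℝ) + 1 : ℝ) : ℂ) by push_cast; ring, Complex.add_re,
      Complex.div_ofReal_re, Complex.one_re]
  have : 0 < z.re / ((m : ℝ) + 1) := by positivity
  calc (1 : ℝ) ≤ (1 + z / ((m : ℂ) + 1)).re := by rw [h]; linarith
    _ ≤ _ := Complex.re_le_norm _

theorem growth_ne_zero {z : ℂ} (hz : 0 < z.re) (m : ℕ) : growth z m ≠ 0 := by
  refine Finset.prod_ne_zero_iff.2 fun k _ h => ?_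
  have := one_le_norm_one_add_div hz k
  rw [h, norm_zero] at this
  linarith

/-- Follows from `|1 - ζ|² = |1 + ζ|² - 4 Re ζ` and `|1 + ζ| ≤ 1 + ‖z‖`. A deficit of order `1 / m`
suffices to kill the recessive component after division by `growth z m`. -/
theorem norm_one_sub_div_le {z : ℂ} (hz : 0 < z.re) (m : ℕ) :
    ‖1 - z / ((m : ℂ) + 1)‖ ≤
      (1 - 2 * z.re / (1 + ‖z‖) ^ 2 / (m + 1)) * ‖1 + z / ((m : ℂ) + 1)‖ := by
  set t : ℝ := (m : ℝ) + 1 with ht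
  have ht1 : 1 ≤ t := by rw [ht]; linarith [(Nat.cast_nonneg m : (0 : ℝ) ≤ m)]
  have ht0 : 0 < t := by linarith
  set ζ := z / ((m : ℂ) + 1) with hζ
  have hre : ζ.re = z.re / t := by
    rw [hζ, show (m : ℂ) + 1 = (t : ℂ) by rw [ht]; push_cast; ring, Complex.div_ofReal_re]
  have hn : ‖ζ‖ ≤ ‖z‖ := by
    rw [hζ, norm_div, norm_natCast_add_one]
    exact div_le_self (norm_nonneg _) ht1
  have hup : ‖1 + ζ‖ ≤ 1 + ‖z‖ := by
    refine (norm_add_le _ _).trans ?_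
    rw [norm_one]
    linarith
  have hsq : ‖1 - ζ‖ ^ 2 = ‖1 + ζ‖ ^ 2 - 4 * ζ.re := by
    rw [← Complex.normSq_eq_norm_sq, ← Complex.normSq_eq_norm_sq, Complex.normSq_apply,
      Complex.normSq_apply]
    simp
    ring
  set r := 2 * z.re / (1 + ‖z‖) ^ 2 / t with hr
  have hz1 : z.re ≤ ‖z‖ := Complex.re_le_norm z
  have hr1 : r ≤ 1 := by
    rw [hr, div_div, div_le_one (by positivity)]
    have : (1 + ‖z‖) ^ 2 * 1 ≤ (1 + ‖z‖) ^ 2 * t := by gcongr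
    nlinarith [norm_nonneg z]
  have hr2 : r * ‖1 + ζ‖ ^ 2 ≤ 2 * ζ.re := by
    calc r * ‖1 + ζ‖ ^ 2 ≤ r * (1 + ‖z‖) ^ 2 := by
          have : 0 ≤ r := by positivity
          gcongr
      _ = 2 * ζ.re := by
          rw [hr, hre]
          have : (1 + ‖z‖) ≠ 0 := by positivity
          field_simp
  refine abs_le_of_sq_le_sq' ?_ (mul_nonneg (by linarith) (norm_nonneg _)) |>.2
  rw [hsq, mul_pow]
  nlinarith [sq_nonneg (r * ‖1 + ζ‖)]

/-- The solution `y`, normalized by the growth of a dominant solution, tends to `l`. -/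
def HasGrowth (z : ℂ) (y : ℕ → ℂ) (l : ℂ) : Prop :=
  Tendsto (fun n => normalized y n / growth z (n / 2)) atTop (𝓝 l)

theorem HasGrowth.even {z l : ℂ} {y : ℕ → ℂ} (h : HasGrowth z y l) :
    Tendsto (fun m => normalized y (2 * m) / growth z m) atTop (𝓝 l) := by
  have := h.comp (tendsto_id.const_mul_atTop' (r := 2) (by norm_num))
  refine this.congr fun m => ?_
  simp

theorem HasGrowth.odd {z l : ℂ} {y : ℕ → ℂ} (h : HasGrowth z y l) :
    Tendsto (fun m => normalized y (2 * m + 1) / growth z m) atTop (𝓝 l) := by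
  have := h.comp ((tendsto_add_atTop_nat 1).comp
    (tendsto_id.const_mul_atTop' (r := 2) (by norm_num)))
  refine this.congr fun m => ?_
  simp [show (2 * m + 1) / 2 = m by omega]

theorem hasGrowth_of_even_odd {z l : ℂ} {y : ℕ → ℂ}
    (he : Tendsto (fun m => normalized y (2 * m) / growth z m) atTop (𝓝 l))
    (ho : Tendsto (fun m => normalized y (2 * m + 1) / growth z m) atTop (𝓝 l)) :
    HasGrowth z y l := by
  refine tendsto_atTop_of_even_odd ?_ ?_
  · simpa using he
  · simpa [show ∀ m, (2 * m + 1) / 2 = m by omega] using ho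

theorem HasGrowth.unique {z l l' : ℂ} {y : ℕ → ℂ} (h : HasGrowth z y l) (h' : HasGrowth z y l') :
    l = l' :=
  tendsto_nhds_unique h h'

theorem HasGrowth.add {z l l' : ℂ} {y y' : ℕ → ℂ} (h : HasGrowth z y l) (h' : HasGrowth z y' l') :
    HasGrowth z (fun n => y n + y' n) (l + l') := by
  refine (Tendsto.add h h').congr fun n => ?_
  simp only [normalized]
  ring

theorem HasGrowth.const_mul {z l : ℂ} {y : ℕ → ℂ} (c : ℂ) (h : HasGrowth z y l) :
    HasGrowth z (fun n => c * y n) (c * l) := by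
  refine (Tendsto.const_mul c h).congr fun n => ?_
  simp only [normalized]
  ring

/-- The coordinates `p = (x * v + x' * w) / (2 * z)` and `q = v - w` diagonalize the leading matrix,
with eigenvalues `z` and `-z`. Dividing by `growth z m` makes `p` converge and `q` tend to zero, so
`v` and `w` share the limit of `p`. The relative error bound serves the case `l = 0`. -/
theorem IsSol.exists_hasGrowth {α β x : ℂ} (hz : 0 < (x + 1 - α - β).re) {y : ℕ → ℂ}
    (hy : IsSol α β x y) : ∃ l, HasGrowth (x + 1 - α - β) y l ∧ ∃ C : ℝ, ∀ m : ℕ,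
      ‖(x * normalized y (2 * m + 1) + (x + 2 * (1 - α - β)) * normalized y (2 * m)) /
        (2 * (x + 1 - α - β)) / growth (x + 1 - α - β) m - l‖ ≤ C / (m + 1) *
        (‖(x * normalized y (2 * m + 1) + (x + 2 * (1 - α - β)) * normalized y (2 * m)) /
        (2 * (x + 1 - α - β)) / growth (x + 1 - α - β) m‖ +
        ‖(normalized y (2 * m + 1) - normalized y (2 * m)) / growth (x + 1 - α - β) m‖) := by
  obtain ⟨K, hK, h⟩ := IsSol.exists_norm_normalized_sub_le α β x
  replace h := h y hy
  set z := x + 1 - α - β with hzdef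
  set c := 1 - α - β with hc
  set x' := x + 2 * c with hx'
  have hz0 : z ≠ 0 := fun h0 => by rw [h0] at hz; simp at hz
  have hzn : 0 < ‖z‖ := norm_pos_iff.2 hz0
  have hxz : x' + x = 2 * z := by rw [hx', hzdef, hc]; ring
  have hxc : x + c = z := by rw [hzdef, hc]; ring
  set v : ℕ → ℂ := fun m => normalized y (2 * m + 1) with hv
  set w : ℕ → ℂ := fun m => normalized y (2 * m) with hw
  set p : ℕ → ℂ := fun m => (x * v m + x' * w m) / (2 * z) with hp
  set q : ℕ → ℂ := fun m => v m - w m with hq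
  have hvpq : ∀ m, v m = p m + x' / (2 * z) * q m := fun m => by
    simp only [hp, hq]
    rw [← hxz]
    have : x' + x ≠ 0 := by rw [hxz]; exact mul_ne_zero two_ne_zero hz0
    field_simp
    ring
  have hwpq : ∀ m, w m = p m - x / (2 * z) * q m := fun m => by
    simp only [hp, hq]
    rw [← hxz]
    have : x' + x ≠ 0 := by rw [hxz]; exact mul_ne_zero two_ne_zero hz0
    field_simp
    ring
  set D : ℝ := 2 + ‖x' / (2 * z)‖ + ‖x / (2 * z)‖ with hD
  have hvw : ∀ m, ‖v m‖ + ‖w m‖ ≤ D * (‖p m‖ + ‖q m‖) := fun m => by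
    have h1 : ‖v m‖ ≤ ‖p m‖ + ‖x' / (2 * z)‖ * ‖q m‖ := by
      rw [hvpq, ← norm_mul]
      exact norm_add_le _ _
    have h2 : ‖w m‖ ≤ ‖p m‖ + ‖x / (2 * z)‖ * ‖q m‖ := by
      rw [hwpq, ← norm_mul]
      exact norm_sub_le _ _
    have h3 : 0 ≤ (‖x' / (2 * z)‖ + ‖x / (2 * z)‖) * ‖p m‖ := by positivity
    rw [hD]
    linarith [norm_nonneg (q m)]
  set ew : ℕ → ℂ := fun m => w (m + 1) - w m - (x * v m + c * w m) / (m + 1) with hew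
  set ev : ℕ → ℂ := fun m => v (m + 1) - v m - (x' * w m - c * v m) / (m + 1) with hev
  have hpstep : ∀ m : ℕ, p (m + 1) = (1 + z / (m + 1)) * p m + (x * ev m + x' * ew m) / (2 * z) := by
    intro m
    have h1 : (m : ℂ) + 1 ≠ 0 := by exact_mod_cast Nat.succ_ne_zero m
    simp only [hp, hev, hew]
    rw [← hxc] at hz0 ⊢
    rw [hx']
    field_simp
    ring
  have hqstep : ∀ m : ℕ, q (m + 1) = (1 - z / (m + 1)) * q m + (ev m - ew m) := by
    intro m
    have h1 : (m : ℂ) + 1 ≠ 0 := by exact_mod_cast Nat.succ_ne_zero m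
    simp only [hq, hev, hew]
    rw [← hxc, hx']
    field_simp
    ring
  set K' : ℝ := ((‖x‖ + ‖x'‖) / (2 * ‖z‖) + 2) * (K * D) with hK'
  have hD0 : 0 ≤ D := by positivity
  have hsmall : ∀ m : ℕ, K / ((m : ℝ) + 1) ^ 2 * (‖v m‖ + ‖w m‖) ≤
      K * D / ((m : ℝ) + 1) ^ 2 * (‖p m‖ + ‖q m‖) := fun m => by
    calc _ ≤ K / ((m : ℝ) + 1) ^ 2 * (D * (‖p m‖ + ‖q m‖)) := by gcongr; exact hvw m
      _ = _ := by ring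
  have hep : ∀ m : ℕ, ‖(x * ev m + x' * ew m) / (2 * z)‖ ≤
      K' / ((m : ℝ) + 1) ^ 2 * (‖p m‖ + ‖q m‖) := by
    intro m
    have h1 := (h m).1.trans (hsmall m)
    have h2 := (h m).2.trans (hsmall m)
    set T := K * D / ((m : ℝ) + 1) ^ 2 * (‖p m‖ + ‖q m‖) with hT
    have hT0 : 0 ≤ T := by positivity
    rw [norm_div, norm_mul, Complex.norm_ofNat]
    have h3 : ‖x * ev m + x' * ew m‖ ≤ (‖x‖ + ‖x'‖) * T := by
      refine (norm_add_le _ _).trans ?_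
      rw [norm_mul, norm_mul, add_mul]
      gcongr
    calc _ ≤ (‖x‖ + ‖x'‖) * T / (2 * ‖z‖) := by gcongr
      _ = (‖x‖ + ‖x'‖) / (2 * ‖z‖) * T := by ring
      _ ≤ ((‖x‖ + ‖x'‖) / (2 * ‖z‖) + 2) * T := by gcongr; linarith
      _ = _ := by rw [hT, hK']; ring
  have heq : ∀ m : ℕ, ‖ev m - ew m‖ ≤ K' / ((m : ℝ) + 1) ^ 2 * (‖p m‖ + ‖q m‖) := by
    intro m
    have h1 := (h m).1.trans (hsmall m)
    have h2 := (h m).2.trans (hsmall m)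
    set T := K * D / ((m : ℝ) + 1) ^ 2 * (‖p m‖ + ‖q m‖) with hT
    have hT0 : 0 ≤ T := by positivity
    have h3 : 0 ≤ (‖x‖ + ‖x'‖) / (2 * ‖z‖) := by positivity
    calc ‖ev m - ew m‖ ≤ ‖ev m‖ + ‖ew m‖ := norm_sub_le _ _
      _ ≤ T + T := add_le_add h2 h1
      _ ≤ ((‖x‖ + ‖x'‖) / (2 * ‖z‖) + 2) * T := by
        have := mul_nonneg h3 hT0
        linarith
      _ = _ := by rw [hT, hK']; ring
  have hK'0 : 0 ≤ K' := by positivity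
  have hE0 := growth_ne_zero hz
  have hE1 := one_le_norm_one_add_div hz
  have hF0 : ∀ m : ℕ, 1 + z / ((m : ℂ) + 1) ≠ 0 := fun m h0 => by
    have := hE1 m
    rw [h0, norm_zero] at this
    linarith
  have hbound : ∀ (m : ℕ) (e : ℂ), ‖e‖ ≤ K' / ((m : ℝ) + 1) ^ 2 * (‖p m‖ + ‖q m‖) →
      ‖e / growth z (m + 1)‖ ≤
        K' / ((m : ℝ) + 1) ^ 2 * (‖p m / growth z m‖ + ‖q m / growth z m‖) := by
    intro m e he
    have hEm : 0 < ‖growth z m‖ := norm_pos_iff.2 (hE0 m)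
    rw [growth_succ, norm_div e, norm_mul, norm_div (p m), norm_div (q m)]
    calc ‖e‖ / (‖growth z m‖ * ‖1 + z / ((m : ℂ) + 1)‖) ≤ ‖e‖ / (‖growth z m‖ * 1) := by
          gcongr
          exact hE1 m
      _ ≤ (K' / ((m : ℝ) + 1) ^ 2 * (‖p m‖ + ‖q m‖)) / (‖growth z m‖ * 1) := by gcongr
      _ = _ := by ring
  obtain ⟨l, hPl, hQ0, C, hC⟩ := exists_limit_of_perturbed_diagonal
    (P := fun m => p m / growth z m) (Q := fun m => q m / growth z m)
    (θ := 2 * z.re / (1 + ‖z‖) ^ 2) hK'0 (by positivity)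
    (fun m => by
      have e : p (m + 1) / growth z (m + 1) - p m / growth z m =
          (x * ev m + x' * ew m) / (2 * z) / growth z (m + 1) := by
        rw [hpstep, growth_succ]
        have := hF0 m
        rw [add_div, mul_comm (growth z m), mul_div_mul_left _ _ this]
        ring
      rw [e]
      exact hbound m _ (hep m))
    (fun m => by
      have e : q (m + 1) / growth z (m + 1) =
          (1 - z / (m + 1)) / (1 + z / (m + 1)) * (q m / growth z m) +
            (ev m - ew m) / growth z (m + 1) := by
        rw [hqstep, growth_succ, add_div]
        congr 1
        rw [div_mul_div_comm, mul_comm (growth z m)]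
      rw [e]
      refine (norm_add_le _ _).trans (add_le_add ?_ (hbound m _ (heq m)))
      rw [norm_mul]
      gcongr
      rw [norm_div, div_le_iff₀ (norm_pos_iff.2 (hF0 m))]
      exact norm_one_sub_div_le hz m)
  refine ⟨l, hasGrowth_of_even_odd ?_ ?_, C, hC⟩
  · have := hPl.sub (hQ0.const_mul (x / (2 * z)))
    rw [mul_zero, sub_zero] at this
    refine this.congr fun m => ?_
    change _ = w m / growth z m
    rw [hwpq]
    ring
  · have := hPl.add (hQ0.const_mul (x' / (2 * z)))
    rw [mul_zero, add_zero] at this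
    refine this.congr fun m => ?_
    change _ = v m / growth z m
    rw [hvpq]
    ring

/-- The ratios of consecutive terms of a recessive solution. -/
theorem IsSol.tendsto_div_of_hasGrowth_zero {α β x : ℂ} (hz : 0 < (x + 1 - α - β).re) (hx : x ≠ 0)
    {y : ℕ → ℂ} (hy : IsSol α β x y) (hy0 : HasGrowth (x + 1 - α - β) y 0)
    (hne : ∀ n, normalized y n ≠ 0) :
    Tendsto (fun m => normalized y (2 * m + 1) / normalized y (2 * m)) atTop
      (𝓝 (-((x + 2 * (1 - α - β)) / x))) := by
  obtain ⟨l, hl, C, hC⟩ := hy.exists_hasGrowth hz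
  obtain rfl := hl.unique hy0
  have hE0 := growth_ne_zero hz
  set z := x + 1 - α - β with hzdef
  set x' := x + 2 * (1 - α - β) with hx'
  have hz0 : z ≠ 0 := fun h0 => by rw [h0] at hz; simp at hz
  have hxz : x' + x = 2 * z := by rw [hx', hzdef]; ring
  set P : ℕ → ℂ := fun m =>
    (x * normalized y (2 * m + 1) + x' * normalized y (2 * m)) / (2 * z) / growth z m with hP
  set Q : ℕ → ℂ := fun m =>
    (normalized y (2 * m + 1) - normalized y (2 * m)) / growth z m with hQ
  have hxz0 : x' + x ≠ 0 := by rw [hxz]; exact mul_ne_zero two_ne_zero hz0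
  have hv : ∀ m, normalized y (2 * m + 1) = growth z m * (P m + x' / (2 * z) * Q m) := fun m => by
    simp only [hP, hQ]
    rw [← hxz]
    have := hE0 m
    field_simp
    ring
  have hw : ∀ m, normalized y (2 * m) = growth z m * (P m - x / (2 * z) * Q m) := fun m => by
    simp only [hP, hQ]
    rw [← hxz]
    have := hE0 m
    field_simp
    ring
  have hCm : ∀ᶠ m : ℕ in atTop, C / ((m : ℝ) + 1) ≤ 1 / 2 := by
    have h : Tendsto (fun m : ℕ => C / ((m : ℝ) + 1)) atTop (𝓝 0) := by
      have := (tendsto_one_div_add_atTop_nhds_zero_nat (𝕜 := ℝ)).const_mul C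
      rw [mul_zero] at this
      exact this.congr fun m => by ring
    exact h.eventually_le_const (by norm_num)
  -- With limit `0` the relative bound reads `‖P‖ ≤ C / (m + 1) * (‖P‖ + ‖Q‖)`; once `C / (m + 1) ≤
  -- 1 / 2` it yields `P = O(Q / m)`. The solution therefore aligns with the eigenvector `p = 0`.
  have hPQ : ∀ᶠ m : ℕ in atTop, Q m ≠ 0 ∧ ‖P m / Q m‖ ≤ 2 * C * (1 / ((m : ℝ) + 1)) := by
    filter_upwards [hCm] with m hm
    have h1 := hC m
    rw [sub_zero] at h1
    have h2 : ‖P m‖ ≤ 2 * C * (1 / ((m : ℝ) + 1)) * ‖Q m‖ := by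
      have h3 : C / ((m : ℝ) + 1) * ‖P m‖ ≤ 1 / 2 * ‖P m‖ := by gcongr
      have h4 : 2 * C * (1 / ((m : ℝ) + 1)) * ‖Q m‖ = 2 * (C / ((m : ℝ) + 1) * ‖Q m‖) := by ring
      rw [h4]
      change ‖P m‖ ≤ C / ((m : ℝ) + 1) * (‖P m‖ + ‖Q m‖) at h1
      linarith
    have hQ0 : Q m ≠ 0 := fun h0 => by
      rw [h0, norm_zero, mul_zero] at h2
      have hP0 : P m = 0 := norm_le_zero_iff.1 h2
      apply hne (2 * m)
      rw [hw, hP0, h0]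
      ring
    refine ⟨hQ0, ?_⟩
    rw [norm_div, div_le_iff₀ (norm_pos_iff.2 hQ0)]
    exact h2
  have hlim : Tendsto (fun m => P m / Q m) atTop (𝓝 0) := by
    refine squeeze_zero_norm' (hPQ.mono fun m hm => hm.2) ?_
    have := (tendsto_one_div_add_atTop_nhds_zero_nat (𝕜 := ℝ)).const_mul (2 * C)
    rwa [mul_zero] at this
  have hden : (0 : ℂ) - x / (2 * z) ≠ 0 := by
    rw [zero_sub]
    exact neg_ne_zero.2 (div_ne_zero hx (mul_ne_zero two_ne_zero hz0))
  have hfin := (hlim.add_const (x' / (2 * z))).div (hlim.sub_const (x / (2 * z))) hden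
  have e : (0 + x' / (2 * z)) / (0 - x / (2 * z)) = -(x' / x) := by
    rw [zero_add, zero_sub, div_neg,
      div_div_div_cancel_right₀ (mul_ne_zero two_ne_zero hz0)]
  rw [e] at hfin
  refine hfin.congr' ?_
  filter_upwards [hPQ] with m hm
  have hQm := hm.1
  rw [hv, hw, mul_div_mul_left _ _ (hE0 m)]
  simp only [Pi.div_apply]
  rw [div_add' _ _ _ hQm, div_sub' hQm, div_div_div_cancel_right₀ hQm]
  congr 1
  ring

/-! ### The transformation from `x` to `x + 2` -/

/-- The solution of the three-term recurrence with the given initial values. -/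
def solution (α β x y₀ y₁ : ℂ) : ℕ → ℂ
  | 0 => y₀
  | 1 => y₁
  | n + 2 => (x + lam α β (n + 1)) * solution α β x y₀ y₁ (n + 1) +
      kappa α β (n + 1) * solution α β x y₀ y₁ n

theorem isSol_solution (α β x y₀ y₁ : ℂ) : IsSol α β x (solution α β x y₀ y₁) := fun n => by
  rw [solution]

/-- The numerator of `G (x + 2) / G x`, for `G` the quotient of Gamma products. -/
def shiftNum (α β x : ℂ) : ℂ := x * (x - 2 * α - β + 2) * (x - α - 2 * β + 2)

/-- The denominator of `G (x + 2) / G x`, for `G` the quotient of Gamma products. -/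
def shiftDen (α β x : ℂ) : ℂ := (x - α + 2) * (x - 2 * (α + β) + 2) * (x - β + 2)

/-- The Bauer–Muir type transformation of solutions at `x` into solutions at `x + 2`. -/
def shiftSol (α β x : ℂ) (y : ℕ → ℂ) (n : ℕ) : ℂ :=
  if Even n then
    (2 * x * n ^ 2 - 2 * x * (x + 2 * (1 - α - β)) * n + shiftNum α β x) * y n +
      4 * n * (x + 2 * (1 - α - β)) * y (n + 1)
  else
    (2 * (x + 2 * (1 - α - β)) * n ^ 2 - 2 * x * (x + 2 * (1 - α - β)) * n + shiftDen α β x -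
      2 * (x + 2 * (1 - α - β)) * (1 + x)) * y n + 4 * n * x * y (n + 1)

theorem shiftSol_even (α β x : ℂ) (y : ℕ → ℂ) (m : ℕ) : shiftSol α β x y (2 * m) =
    (2 * x * (2 * m) ^ 2 - 2 * x * (x + 2 * (1 - α - β)) * (2 * m) + shiftNum α β x) * y (2 * m) +
      4 * (2 * m) * (x + 2 * (1 - α - β)) * y (2 * m + 1) := by
  rw [shiftSol, if_pos (even_two_mul m)]
  push_cast
  rfl

theorem shiftSol_odd (α β x : ℂ) (y : ℕ → ℂ) (m : ℕ) : shiftSol α β x y (2 * m + 1) =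
    (2 * (x + 2 * (1 - α - β)) * (2 * m + 1) ^ 2 -
      2 * x * (x + 2 * (1 - α - β)) * (2 * m + 1) + shiftDen α β x -
      2 * (x + 2 * (1 - α - β)) * (1 + x)) * y (2 * m + 1) +
      4 * (2 * m + 1) * x * y (2 * m + 2) := by
  rw [shiftSol, if_neg (by simp)]
  push_cast
  rfl

theorem isSol_of_even_odd {α β x : ℂ} {y : ℕ → ℂ}
    (he : ∀ m : ℕ, y (2 * m + 2) = (x + 2 * (1 - α - β)) * y (2 * m + 1) +
      (2 * m + α + β) * (2 * m + α) * (2 * m + β) / (4 * (2 * m + 1)) * y (2 * m))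
    (ho : ∀ m : ℕ, y (2 * m + 3) = x * y (2 * m + 2) + (2 * m + 2 - α - β) * (2 * m + 2 - α) *
      (2 * m + 2 - β) / (4 * (2 * m + 1)) * y (2 * m + 1)) : IsSol α β x y := by
  intro n
  rcases Nat.even_or_odd' n with ⟨m, rfl | rfl⟩
  · rw [he, lam_odd, kappa_odd]
  · have h := kappa_two_mul α β (m + 1)
    have h' := lam_even α β (m + 1)
    rw [show 2 * (m + 1) = 2 * m + 1 + 1 by ring] at h h'
    rw [ho m, h, h']
    push_cast
    ring_nf

/-- The recurrence eliminates all but two consecutive values of `y`; what remains, for each parity,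
is a rational identity in `m`, `α`, `β`, `x`. -/
theorem IsSol.shift {α β x : ℂ} {y : ℕ → ℂ} (hy : IsSol α β x y) :
    IsSol α β (x + 2) (shiftSol α β x y) := by
  refine isSol_of_even_odd (fun m => ?_) (fun m => ?_)
  · have h := shiftSol_even α β x y (m + 1)
    rw [show 2 * (m + 1) = 2 * m + 2 by ring, show 2 * m + 2 + 1 = 2 * m + 3 by ring, hy.odd,
      hy.even] at h
    rw [h, shiftSol_odd, shiftSol_even, hy.even]
    have h1 : (2 * m : ℂ) + 1 ≠ 0 := by exact_mod_cast Nat.succ_ne_zero (2 * m)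
    simp only [shiftNum, shiftDen]
    push_cast
    field_simp
    ring
  · have h := shiftSol_odd α β x y (m + 1)
    have h' := shiftSol_even α β x y (m + 1)
    have e := hy.even (m + 1)
    simp only [show 2 * (m + 1) = 2 * m + 2 by ring, show 2 * m + 2 + 1 = 2 * m + 3 by ring] at h h' e
    rw [h, h', shiftSol_odd, e, hy.odd]
    have h1 : (2 * m : ℂ) + 1 ≠ 0 := by exact_mod_cast Nat.succ_ne_zero (2 * m)
    have h2 : (2 * (m + 1) : ℂ) + 1 ≠ 0 := by exact_mod_cast Nat.succ_ne_zero (2 * (m + 1))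
    simp only [shiftNum, shiftDen]
    push_cast
    field_simp
    ring

/-- Both sides solve the recurrence at `x + 2`, so agreement at `n = 0` and `n = 1` suffices. -/
theorem shiftSol_numerators (α β x : ℂ) (n : ℕ) :
    shiftSol α β x (solution α β x 0 1) n = shiftDen α β x * solution α β (x + 2) 0 1 n := by
  refine (isSol_solution α β x 0 1).shift.ext ((isSol_solution α β (x + 2) 0 1).const_mul _)
    ?_ ?_ n
  · simpa [solution] using shiftSol_even α β x (solution α β x 0 1) 0
  · have h := shiftSol_odd α β x (solution α β x 0 1) 0
    simp only [mul_zero, zero_add] at h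
    rw [h, (isSol_solution α β x 0 1) 0]
    simp [solution, lam]
    ring

theorem shiftSol_denominators (α β x : ℂ) (n : ℕ) :
    shiftSol α β x (solution α β x 1 (x / 2)) n =
      shiftNum α β x * solution α β (x + 2) 1 ((x + 2) / 2) n := by
  refine (isSol_solution α β x 1 (x / 2)).shift.ext
    ((isSol_solution α β (x + 2) 1 ((x + 2) / 2)).const_mul _) ?_ ?_ n
  · simpa [solution] using shiftSol_even α β x (solution α β x 1 (x / 2)) 0
  · have h := shiftSol_odd α β x (solution α β x 1 (x / 2)) 0
    simp only [mul_zero, zero_add] at h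
    rw [h, (isSol_solution α β x 1 (x / 2)) 0]
    simp [solution, lam, kappa, shiftNum, shiftDen]
    ring

/-- The quotient of the two products telescopes. -/
theorem growth_add_two (z : ℂ) (m : ℕ) :
    growth (z + 2) m * ((z + 1) * (z + 2)) = growth z m * ((m + (z + 1)) * (m + (z + 2))) := by
  induction m with
  | zero => simp [growth]
  | succ m ih =>
    have h1 : (m : ℂ) + 1 ≠ 0 := by exact_mod_cast Nat.succ_ne_zero m
    rw [growth_succ, growth_succ, mul_right_comm, ih]
    push_cast
    field_simp
    ring

theorem tendsto_quadratic_div (a b c d e : ℂ) :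
    Tendsto (fun m : ℕ => (a * (m : ℂ) ^ 2 + b * m + c) / ((m + d) * (m + e))) atTop (𝓝 a) := by
  have h0 : Tendsto (fun m : ℕ => ((m : ℂ))⁻¹) atTop (𝓝 0) := tendsto_inv_atTop_nhds_zero_nat
  have h1 : Tendsto (fun t : ℂ => (a + b * t + c * t ^ 2) / ((1 + d * t) * (1 + e * t)))
      (𝓝 0) (𝓝 ((a + b * 0 + c * 0 ^ 2) / ((1 + d * 0) * (1 + e * 0)))) := by
    have : ContinuousAt (fun t : ℂ => (a + b * t + c * t ^ 2) / ((1 + d * t) * (1 + e * t))) 0 :=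
      ContinuousAt.div (by fun_prop) (by fun_prop) (by simp)
    exact this
  have h2 := h1.comp h0
  simp only [mul_zero, add_zero, ne_eq, OfNat.ofNat_ne_zero, not_false_eq_true, zero_pow, mul_one,
    div_one] at h2
  refine h2.congr' ?_
  filter_upwards [eventually_ne_atTop 0] with m hm
  have hm' : (m : ℂ) ≠ 0 := by exact_mod_cast hm
  simp only [Function.comp]
  rw [← mul_div_mul_right _ _ (pow_ne_zero 2 hm')]
  congr 1 <;> field_simp

/-- In normalized form the transformation has coefficients quadratic in `m`, with leading terms `8 *
x` and `8 * x'`, whose sum is `16 * z`. The quadratic growth is exactly that of `growth (z + 2) m /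
growth z m`. -/
theorem HasGrowth.shift {α β x l : ℂ} (hz : 0 < (x + 1 - α - β).re) {y : ℕ → ℂ}
    (h : HasGrowth (x + 1 - α - β) y l) :
    HasGrowth (x + 2 + 1 - α - β) (shiftSol α β x y) (16 * (x + 1 - α - β) *
      ((x + 1 - α - β + 1) * (x + 1 - α - β + 2)) * l) := by
  have hE0 := growth_ne_zero hz
  rw [show x + 2 + 1 - α - β = x + 1 - α - β + 2 by ring]
  set z := x + 1 - α - β with hzdef
  set x' := x + 2 * (1 - α - β) with hx'
  have hxz : x' + x = 2 * z := by rw [hx', hzdef]; ring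
  have hz1 : z + 1 ≠ 0 := fun h0 => by
    have := congrArg Complex.re h0
    simp only [Complex.add_re, Complex.one_re, Complex.zero_re] at this
    linarith
  have hz2 : z + 2 ≠ 0 := fun h0 => by
    have := congrArg Complex.re h0
    simp only [Complex.add_re, Complex.re_ofNat, Complex.zero_re] at this
    linarith
  set Z := (z + 1) * (z + 2) with hZ
  have hZ0 : Z ≠ 0 := mul_ne_zero hz1 hz2
  have hE : ∀ (m : ℕ) (a : ℂ), a / growth (z + 2) m =
      Z * (a / (((m : ℂ) + (z + 1)) * (m + (z + 2))) / growth z m) := fun m a => by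
    rw [div_div, mul_comm _ (growth z m), ← growth_add_two, mul_div_assoc', mul_comm,
      mul_div_mul_right _ _ hZ0]
  have hshift : Tendsto (fun m : ℕ => normalized y (2 * (m + 1)) / growth z m) atTop (𝓝 l) := by
    have h1 := (tendsto_add_atTop_iff_nat 1).2 h.even
    have h2 : Tendsto (fun m : ℕ => 1 + z / ((m : ℂ) + 1)) atTop (𝓝 1) := by
      have := ((tendsto_one_div_add_atTop_nhds_zero_nat (𝕜 := ℂ)).const_mul z).const_add 1
      rw [mul_zero, add_zero] at this
      exact this.congr fun m => by ring
    have h3 := h1.mul h2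
    rw [mul_one] at h3
    refine h3.congr fun m => ?_
    rw [growth_succ]
    have h4 : 1 + z / ((m : ℂ) + 1) ≠ 0 := fun h0 => by
      apply hE0 (m + 1)
      rw [growth_succ, h0, mul_zero]
    rw [div_mul_eq_mul_div, mul_div_mul_right _ _ h4]
  refine hasGrowth_of_even_odd ?_ ?_
  · set r := shiftDen α β x - 2 * x' * (1 + x) with hr
    have q1 := (tendsto_quadratic_div (8 * x') (8 * x' - 4 * x * x') (2 * x' - 2 * x * x' + r)
      (z + 1) (z + 2)).mul h.even
    have q2 := (tendsto_quadratic_div (8 * x) (8 * x) (2 * x) (z + 1) (z + 2)).mul h.odd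
    have q := (q1.add q2).const_mul Z
    rw [show Z * (8 * x' * l + 8 * x * l) = 16 * z * Z * l by
      linear_combination 8 * Z * l * hxz] at q
    refine q.congr fun m => ?_
    have e : normalized (shiftSol α β x y) (2 * m) =
        (8 * x' * (m : ℂ) ^ 2 + (8 * x' - 4 * x * x') * m + (2 * x' - 2 * x * x' + r)) *
          normalized y (2 * m) +
        (8 * x * (m : ℂ) ^ 2 + 8 * x * m + 2 * x) * normalized y (2 * m + 1) := by
      simp only [normalized, shiftSol_odd, Nat.factorial_succ]
      have h1 : (2 * m : ℂ) + 1 ≠ 0 := by exact_mod_cast Nat.succ_ne_zero (2 * m)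
      have h3 : ((2 * m).factorial : ℂ) ≠ 0 := by exact_mod_cast Nat.factorial_ne_zero _
      rw [← hx', hr]
      push_cast
      field_simp
      ring
    rw [hE, e]
    ring
  · have q1 := (tendsto_quadratic_div (8 * x) (16 * x - 4 * x * x')
      (8 * x - 4 * x * x' + shiftNum α β x) (z + 1) (z + 2)).mul h.odd
    have q2 := (tendsto_quadratic_div (8 * x') (16 * x') (8 * x') (z + 1) (z + 2)).mul hshift
    have q := (q1.add q2).const_mul Z
    rw [show Z * (8 * x * l + 8 * x' * l) = 16 * z * Z * l by
      linear_combination 8 * Z * l * hxz] at q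
    refine q.congr fun m => ?_
    have e : normalized (shiftSol α β x y) (2 * m + 1) =
        (8 * x * (m : ℂ) ^ 2 + (16 * x - 4 * x * x') * m +
          (8 * x - 4 * x * x' + shiftNum α β x)) * normalized y (2 * m + 1) +
        (8 * x' * (m : ℂ) ^ 2 + 16 * x' * m + 8 * x') * normalized y (2 * (m + 1)) := by
      have hs := shiftSol_even α β x y (m + 1)
      simp only [normalized, show 2 * (m + 1) = 2 * m + 1 + 1 by ring, Nat.factorial_succ] at hs ⊢
      rw [hs, ← hx']
      have h1 : (2 * m : ℂ) + 1 ≠ 0 := by exact_mod_cast Nat.succ_ne_zero (2 * m)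
      have h2 : (2 * m : ℂ) + 1 + 1 ≠ 0 := by exact_mod_cast Nat.succ_ne_zero (2 * m + 1)
      have h3 : ((2 * m).factorial : ℂ) ≠ 0 := by exact_mod_cast Nat.factorial_ne_zero _
      push_cast
      field_simp
      ring
    rw [hE, e]
    ring

/-! ### Parabola-type estimates for large `x.re` -/

theorem norm_ofReal_add_le {s : ℝ} (hs : 0 < s) (c : ℂ) :
    ‖(s : ℂ) + c‖ ≤ s + c.re + ‖c‖ ^ 2 / (2 * s) := by
  have hsq : ‖(s : ℂ) + c‖ ^ 2 = s ^ 2 + 2 * s * c.re + ‖c‖ ^ 2 := by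
    rw [← Complex.normSq_eq_norm_sq, ← Complex.normSq_eq_norm_sq, Complex.normSq_apply,
      Complex.normSq_apply]
    simp
    ring
  have hre : c.re ^ 2 ≤ ‖c‖ ^ 2 := by
    rw [sq_le_sq, abs_norm]
    exact Complex.abs_re_le_norm c
  refine abs_le_of_sq_le_sq' ?_ ?_ |>.2
  · rw [hsq]
    have : (s + c.re + ‖c‖ ^ 2 / (2 * s)) ^ 2 =
        s ^ 2 + 2 * s * c.re + ‖c‖ ^ 2 + (c.re + ‖c‖ ^ 2 / (2 * s)) ^ 2 := by
      field_simp
      ring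
    rw [this]
    linarith [sq_nonneg (c.re + ‖c‖ ^ 2 / (2 * s))]
  · have : s + c.re + ‖c‖ ^ 2 / (2 * s) =
        (2 * s ^ 2 + 2 * s * c.re + ‖c‖ ^ 2) / (2 * s) := by
      field_simp
    rw [this]
    apply div_nonneg _ (by positivity)
    nlinarith [sq_nonneg (s + c.re), sq_nonneg s]

/-- A family of numbers in a parabolic region around the positive real axis. -/
theorem exists_norm_cubic_div_sub_re_le (a b c : ℂ) : ∃ K : ℝ, 0 ≤ K ∧ ∀ t : ℝ, 1 ≤ t →
    ‖(t + a) * (t + b) * (t + c) / (4 * t)‖ - ((t + a) * (t + b) * (t + c) / (4 * t)).re ≤ K := by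
  refine ⟨‖a + b + c‖ ^ 2 / 8 + 2 * (‖a * b + a * c + b * c‖ + ‖a * b * c‖), by positivity,
    fun t ht => ?_⟩
  have ht0 : 0 < t := by linarith
  have htc : (t : ℂ) ≠ 0 := by exact_mod_cast ht0.ne'
  -- `X` carries the growth in `t`: its norm exceeds its real part by at most `(t / 4) * ‖a + b + c‖
  -- ^ 2 / (2 * t)`. The rest `Y` is bounded.
  set X : ℂ := ((t / 4 : ℝ) : ℂ) * (t + (a + b + c)) with hX
  set Y : ℂ := (a * b + a * c + b * c) / 4 + a * b * c / (4 * t) with hY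
  have e : (t + a) * (t + b) * (t + c) / (4 * t) = X + Y := by
    rw [hX, hY]
    push_cast
    field_simp
    ring
  have hXle : ‖X‖ - X.re ≤ ‖a + b + c‖ ^ 2 / 8 := by
    rw [hX, norm_mul, Complex.re_ofReal_mul, Complex.norm_of_nonneg (by positivity),
      Complex.add_re, Complex.ofReal_re]
    have h := norm_ofReal_add_le ht0 (a + b + c)
    have h' := mul_le_mul_of_nonneg_left h (show 0 ≤ t / 4 by positivity)
    have : t / 4 * (t + (a + b + c).re + ‖a + b + c‖ ^ 2 / (2 * t)) =
        t / 4 * (t + (a + b + c).re) + ‖a + b + c‖ ^ 2 / 8 := by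
      field_simp
      ring
    linarith
  have hYle : ‖Y‖ ≤ ‖a * b + a * c + b * c‖ + ‖a * b * c‖ := by
    rw [hY]
    refine (norm_add_le _ _).trans (add_le_add ?_ ?_)
    · rw [norm_div, Complex.norm_ofNat]
      exact div_le_self (norm_nonneg _) (by norm_num)
    · rw [norm_div, norm_mul _ (t : ℂ), Complex.norm_ofNat, Complex.norm_of_nonneg ht0.le]
      exact div_le_self (norm_nonneg _) (by linarith)
  rw [e, Complex.add_re]
  have h1 := norm_add_le X Y
  have h2 := (abs_le.1 (Complex.abs_re_le_norm Y)).1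
  linarith

theorem exists_norm_kappa_sub_re_le (α β : ℂ) : ∃ K : ℝ, 0 ≤ K ∧ ∀ n : ℕ,
    ‖kappa α β (n + 1)‖ - (kappa α β (n + 1)).re ≤ K := by
  obtain ⟨K₁, hK₁, h₁⟩ := exists_norm_cubic_div_sub_re_le (α + β - 1) (α - 1) (β - 1)
  obtain ⟨K₂, hK₂, h₂⟩ := exists_norm_cubic_div_sub_re_le (1 - α - β) (1 - α) (1 - β)
  refine ⟨K₁ + K₂, by positivity, fun n => ?_⟩
  rcases Nat.even_or_odd' n with ⟨m, rfl | rfl⟩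
  · have h := h₁ (2 * m + 1) (by linarith [(Nat.cast_nonneg m : (0 : ℝ) ≤ m)])
    push_cast at h
    rw [kappa_odd]
    rw [show (2 * m + 1 + (α + β - 1)) * (2 * m + 1 + (α - 1)) * (2 * m + 1 + (β - 1)) /
      (4 * (2 * m + 1)) = (2 * m + α + β) * (2 * m + α) * (2 * m + β) / (4 * (2 * m + 1)) by
      ring] at h
    linarith
  · have h := h₂ (2 * m + 1) (by linarith [(Nat.cast_nonneg m : (0 : ℝ) ≤ m)])
    push_cast at h
    rw [show 2 * m + 1 + 1 = 2 * (m + 1) by ring, kappa_two_mul]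
    push_cast
    rw [show (2 * m + 1 + (1 - α - β)) * (2 * m + 1 + (1 - α)) * (2 * m + 1 + (1 - β)) /
      (4 * (2 * m + 1)) = (2 * (m + 1) - α - β) * (2 * (m + 1) - α) * (2 * (m + 1) - β) /
      (4 * (2 * (m + 1) - 1)) by ring_nf] at h
    linarith

/-- Inversion maps `1 ≤ re r` into the disc `‖2 / r - 1‖ ≤ 1`, so `k / r = (k + k * u) / 2` with
`‖u‖ ≤ 1`. -/
theorem le_re_div_of_one_le_re (k : ℂ) {r : ℂ} (hr : 1 ≤ r.re) :
    -((‖k‖ - k.re) / 2) ≤ (k / r).re := by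
  have hr0 : r ≠ 0 := fun h => by rw [h, Complex.zero_re] at hr; linarith
  have h1 : ‖2 / r - 1‖ ≤ 1 := by
    rw [div_sub_one hr0, norm_div, div_le_one (norm_pos_iff.2 hr0)]
    refine abs_le_of_sq_le_sq' ?_ (norm_nonneg _) |>.2
    rw [← Complex.normSq_eq_norm_sq, ← Complex.normSq_eq_norm_sq, Complex.normSq_apply,
      Complex.normSq_apply]
    simp
    nlinarith
  have h2 : k / r = ((1 / 2 : ℝ) : ℂ) * (k + k * (2 / r - 1)) := by
    push_cast
    field_simp
    ring
  have h3 : -‖k‖ ≤ (k * (2 / r - 1)).re := by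
    refine le_trans ?_ (abs_le.1 (Complex.abs_re_le_norm _)).1
    rw [norm_mul, neg_le_neg_iff]
    exact mul_le_of_le_one_right (norm_nonneg _) h1
  rw [h2, Complex.re_ofReal_mul, Complex.add_re]
  linarith

/-- The half-plane `1 ≤ re` is invariant under `r ↦ (x + lam) + kappa / r`: the quotient lowers the
real part by at most `K / 2`. In particular such a solution never vanishes from index `k` on. -/
theorem IsSol.one_le_re_div {α β x : ℂ} {K : ℝ}
    (hK : ∀ n : ℕ, ‖kappa α β (n + 1)‖ - (kappa α β (n + 1)).re ≤ K)
    (hb : ∀ n : ℕ, 1 + K / 2 ≤ (x + lam α β (n + 1)).re) {y : ℕ → ℂ} (hy : IsSol α β x y) {k : ℕ}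
    (hk : y k ≠ 0) (hk' : 1 ≤ (y (k + 1) / y k).re) (n : ℕ) :
    y (k + n) ≠ 0 ∧ 1 ≤ (y (k + n + 1) / y (k + n)).re := by
  induction n with
  | zero => exact ⟨hk, hk'⟩
  | succ n ih =>
    obtain ⟨h0, h1⟩ := ih
    have hne : y (k + n + 1) ≠ 0 := fun h => by
      rw [h, zero_div, Complex.zero_re] at h1
      linarith
    refine ⟨hne, ?_⟩
    rw [← add_assoc, hy (k + n), add_div, mul_div_cancel_right₀ _ hne]
    have e : kappa α β (k + n + 1) * y (k + n) / y (k + n + 1) =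
        kappa α β (k + n + 1) / (y (k + n + 1) / y (k + n)) := by
      field_simp
    rw [e, Complex.add_re]
    have h2 := le_re_div_of_one_le_re (kappa α β (k + n + 1)) h1
    have h3 := hK (k + n)
    have h4 := hb (k + n)
    linarith

theorem normalized_ne_zero {y : ℕ → ℂ} {n : ℕ} (h : y (n + 1) ≠ 0) : normalized y n ≠ 0 := by
  rw [normalized]
  have h3 : (n.factorial : ℂ) ≠ 0 := by exact_mod_cast Nat.factorial_ne_zero _
  have h2 : (2 : ℂ) ^ n ≠ 0 := pow_ne_zero _ two_ne_zero
  positivity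

theorem normalized_succ_div (y : ℕ → ℂ) (n : ℕ) : normalized y (n + 1) / normalized y n =
    ((2 / ((n : ℝ) + 1) : ℝ) : ℂ) * (y (n + 2) / y (n + 1)) := by
  have h1 : (n : ℂ) + 1 ≠ 0 := by exact_mod_cast Nat.succ_ne_zero n
  have h3 : (n.factorial : ℂ) ≠ 0 := by exact_mod_cast Nat.factorial_ne_zero _
  simp only [normalized, Nat.factorial_succ]
  push_cast
  by_cases h : y (n + 1) = 0
  · simp [h]
  · field_simp
    ring

/-- Normalizes the functional equation at infinity: it forces `lB / lA ~ x / 2` along `x + 2 * n`.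
-/
theorem exists_growth_quotient_bound (α β : ℂ) : ∃ R C : ℝ, 0 ≤ R ∧ ∀ x : ℂ, R < x.re →
    0 < (x + 1 - α - β).re ∧ ∀ lA lB : ℂ,
      HasGrowth (x + 1 - α - β) (solution α β x 0 1) lA →
      HasGrowth (x + 1 - α - β) (solution α β x 1 (x / 2)) lB →
      lA ≠ 0 ∧ lB ≠ 0 ∧ ‖lB / (x / 2 * lA) - 1‖ ≤ C / (x.re - R) := by
  obtain ⟨K, hK0, hK⟩ := exists_norm_kappa_sub_re_le α β
  set c := 1 - α - β with hc
  -- This `R` makes the real parts of all partial denominators from index `1` on at least `1 + K /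
  -- 2`, and those of `x / 2` and `z` at least `1` and `0`.
  refine ⟨2 + K + 4 * ‖c‖, ‖kappa α β 1‖, by positivity, fun x hx => ?_⟩
  have hcn := norm_nonneg c
  have hcre := (abs_le.1 (Complex.abs_re_le_norm c)).1
  set x' := x + 2 * c with hx'
  have hx're : x'.re = x.re + 2 * c.re := by simp [hx']
  have hz : 0 < (x + 1 - α - β).re := by
    rw [show x + 1 - α - β = x + c by rw [hc]; ring, Complex.add_re]
    linarith
  have hx0 : x ≠ 0 := fun h => by rw [h, Complex.zero_re] at hx; linarith
  have hb : ∀ n : ℕ, 1 + K / 2 ≤ (x + lam α β (n + 1)).re := fun n => by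
    rcases Nat.even_or_odd' (n + 1) with ⟨m, h | h⟩
    · rw [h, lam_even, add_zero]
      linarith
    · rw [h, lam_odd, ← hc, ← hx', hx're]
      linarith
  refine ⟨hz, fun lA lB hA hB => ?_⟩
  set A := solution α β x 0 1 with hAdef
  set B := solution α β x 1 (x / 2) with hBdef
  have hAs : IsSol α β x A := isSol_solution _ _ _ _ _
  have hBs : IsSol α β x B := isSol_solution _ _ _ _ _
  have hA1 : A 1 = 1 := by rw [hAdef]; simp [solution]
  have hA0 : A 0 = 0 := by rw [hAdef]; simp [solution]
  have hB1 : B 1 = x / 2 := by rw [hBdef]; simp [solution]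
  have hB0 : B 0 = 1 := by rw [hBdef]; simp [solution]
  -- Were `B` recessive, its normalized ratios would tend to `-x' / x`, which has negative real part
  -- since `‖2 * c / x‖ < 1`; but these ratios stay in the right half-plane.
  have hlB : lB ≠ 0 := by
    rintro rfl
    have hreg := hBs.one_le_re_div hK hb (k := 0) (by rw [hB0]; exact one_ne_zero) (by
      rw [zero_add, hB1, hB0, div_one, show x / 2 = ((1 / 2 : ℝ) : ℂ) * x by push_cast; ring,
        Complex.re_ofReal_mul]
      linarith)
    simp only [zero_add] at hreg
    have hlim := hBs.tendsto_div_of_hasGrowth_zero hz hx0 hB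
      (fun n => normalized_ne_zero (hreg (n + 1)).1)
    have hre := ge_of_tendsto' ((Complex.continuous_re.tendsto _).comp hlim) (b := 0) fun m => by
      simp only [Function.comp]
      rw [normalized_succ_div, Complex.re_ofReal_mul]
      have := (hreg (2 * m + 1)).2
      have h1 : (0 : ℝ) ≤ 2 / (((2 * m : ℕ) : ℝ) + 1) := by positivity
      exact mul_nonneg h1 (by linarith)
    have e : x' / x = 1 + 2 * c / x := by rw [hx']; field_simp
    rw [← hc, ← hx', e, Complex.neg_re, Complex.add_re, Complex.one_re] at hre
    have h1 := (abs_le.1 (Complex.abs_re_le_norm (2 * c / x))).1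
    have h2 : ‖2 * c / x‖ < 1 := by
      rw [norm_div, norm_mul, Complex.norm_ofNat, div_lt_one (norm_pos_iff.2 hx0)]
      linarith [Complex.re_le_norm x]
    linarith
  -- `D` starts from `1, 0`, so it measures how far `B` is from `(x / 2) * A`.
  set D : ℕ → ℂ := fun n => B n + -(x / 2) * A n with hD
  have hDs : IsSol α β x D := hBs.add (hAs.const_mul _)
  have hD1 : D 1 = 0 := by simp only [hD, hA1, hB1]; ring
  have hD0 : D 0 = 1 := by simp only [hD, hA0, hB0]; ring
  have hx'1 : x.re - (2 + K + 4 * ‖c‖) ≤ x'.re - 1 := by rw [hx're]; linarith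
  have hpos : 0 < x.re - (2 + K + 4 * ‖c‖) := by linarith
  -- If the bound failed at `n + 1`, then `A - τ * D` with `τ = A (n + 1) / D (n + 1)` would start,
  -- at index `1`, with ratio `x' - τ * kappa α β 1` of real part at least `1`. It could then never
  -- vanish, yet it does at `n + 1`.
  have hbound : ∀ n, (x'.re - 1) * ‖D (n + 1)‖ ≤ ‖kappa α β 1‖ * ‖A (n + 1)‖ := by
    intro n
    by_contra! hcon
    have hDn : D (n + 1) ≠ 0 := fun h0 => by
      rw [h0, norm_zero, mul_zero] at hcon
      exact absurd hcon (not_lt.2 (by positivity))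
    set τ := A (n + 1) / D (n + 1) with hτ
    have hτn : ‖τ * kappa α β 1‖ ≤ x'.re - 1 := by
      rw [hτ, norm_mul, norm_div, div_mul_eq_mul_div, div_le_iff₀ (norm_pos_iff.2 hDn)]
      linarith
    have hEs : IsSol α β x (fun n => A n + -τ * D n) := hAs.add (hDs.const_mul _)
    have := hEs.one_le_re_div hK hb (k := 1) (by simp [hA1, hD1]) (by
      have h2 : A 2 = x' := by
        have := hAs.even 0
        simpa [hA1, hA0, ← hc, ← hx'] using this
      have h3 : D 2 = kappa α β 1 := by
        have := hDs 0
        simpa [hD1, hD0] using this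
      simp only [hA1, hD1, Nat.reduceAdd, h2, h3, mul_zero, add_zero, div_one, neg_mul,
        Complex.add_re, Complex.neg_re]
      linarith [Complex.re_le_norm (τ * kappa α β 1)]) n
    apply this.1
    rw [add_comm 1 n, hτ]
    field_simp
    ring
  have hDg := hB.add (hA.const_mul (-(x / 2)))
  have hlim : (x'.re - 1) * ‖lB + -(x / 2) * lA‖ ≤ ‖kappa α β 1‖ * ‖lA‖ := by
    refine le_of_tendsto_of_tendsto' ((Tendsto.norm hDg).const_mul (x'.re - 1))
      ((Tendsto.norm hA).const_mul ‖kappa α β 1‖) fun n => ?_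
    have h1 := hbound n
    have e : ∀ y : ℕ → ℂ, ‖normalized y n / growth (x + 1 - α - β) (n / 2)‖ =
        ‖y (n + 1)‖ * ‖(2 : ℂ) ^ n / n.factorial / growth (x + 1 - α - β) (n / 2)‖ := fun y => by
      rw [← norm_mul, normalized]
      congr 1
      ring
    rw [e, e, ← mul_assoc, ← mul_assoc]
    exact mul_le_mul_of_nonneg_right h1 (norm_nonneg _)
  have hlA : lA ≠ 0 := by
    rintro rfl
    rw [mul_zero, add_zero, norm_zero, mul_zero] at hlim
    have : 0 < (x'.re - 1) * ‖lB‖ := mul_pos (by linarith) (norm_pos_iff.2 hlB)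
    linarith
  refine ⟨hlA, hlB, ?_⟩
  have hxn : 1 ≤ ‖x / 2‖ := by
    rw [norm_div, Complex.norm_ofNat, le_div_iff₀ two_pos]
    linarith [Complex.re_le_norm x]
  have hx2 : x / 2 * lA ≠ 0 := mul_ne_zero (div_ne_zero hx0 two_ne_zero) hlA
  rw [div_sub_one hx2, norm_div, div_le_div_iff₀ (norm_pos_iff.2 hx2) hpos, norm_mul]
  have e : lB - x / 2 * lA = lB + -(x / 2) * lA := by ring
  rw [e]
  calc ‖lB + -(x / 2) * lA‖ * (x.re - (2 + K + 4 * ‖c‖))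
      ≤ ‖lB + -(x / 2) * lA‖ * (x'.re - 1) := by gcongr
    _ ≤ ‖kappa α β 1‖ * ‖lA‖ := by linarith
    _ ≤ ‖kappa α β 1‖ * (‖x / 2‖ * ‖lA‖) := by
      gcongr
      exact le_mul_of_one_le_left (norm_nonneg _) hxn

/-! ### The Gamma quotient: functional equation and asymptotics -/

theorem Gamma_add_natCast_succ {s : ℂ} (hs : ∀ k : ℕ, s ≠ -k) (n : ℕ) :
    Complex.Gamma (s + (n + 1)) = Complex.Gamma s * ∏ j ∈ Finset.range (n + 1), (s + j) := by
  induction n with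
  | zero =>
    have := hs 0
    simp only [Nat.cast_zero, neg_zero] at this
    simp [Complex.Gamma_add_one s this, mul_comm]
  | succ n ih =>
    have h : s + ((n : ℂ) + 1) ≠ 0 := fun h0 => hs (n + 1) (by
      push_cast
      linear_combination h0)
    rw [Finset.prod_range_succ, ← mul_assoc, ← ih]
    push_cast
    rw [← add_assoc s, Complex.Gamma_add_one _ h]
    ring

/-- Euler's limit formula for `Γ(s)`, rewritten as `Γ(s + n + 1) ~ n ^ s * n!`. -/
theorem tendsto_cpow_mul_factorial_div_Gamma {s : ℂ} (hs : ∀ k : ℕ, s ≠ -k) :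
    Tendsto (fun n : ℕ => (n : ℂ) ^ s * n.factorial / Complex.Gamma (s + (n + 1))) atTop (𝓝 1) := by
  have h := (Complex.GammaSeq_tendsto_Gamma s).div_const (Complex.Gamma s)
  rw [div_self (Complex.Gamma_ne_zero hs)] at h
  refine h.congr fun n => ?_
  rw [Gamma_add_natCast_succ hs, Complex.GammaSeq, div_div, mul_comm (Complex.Gamma s)]

/-- The quotient of Gamma products representing the continued fraction. -/
def gammaQuotient (α β x : ℂ) : ℂ :=
  Complex.Gamma ((x - 2 * α - β + 2) / 2) * Complex.Gamma (x / 2) *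
    Complex.Gamma ((x - α - 2 * β + 2) / 2) /
  (Complex.Gamma ((x - α + 2) / 2) * Complex.Gamma ((x - 2 * (α + β) + 2) / 2) *
    Complex.Gamma ((x - β + 2) / 2))

/-- Stated without division because `shiftDen` may vanish. The denominator factors are handled
through `1 / Γ(s) = s / Γ(s + 1)`, which holds at the poles too. -/
theorem gammaQuotient_add_two_mul {α β x : ℂ} (h : shiftNum α β x ≠ 0) :
    gammaQuotient α β (x + 2) * shiftDen α β x = gammaQuotient α β x * shiftNum α β x := by
  simp only [shiftNum, ne_eq, mul_eq_zero, not_or] at h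
  obtain ⟨⟨h2, h1⟩, h3⟩ := h
  simp only [gammaQuotient, shiftNum, shiftDen]
  rw [show (x + 2 - 2 * α - β + 2) / 2 = (x - 2 * α - β + 2) / 2 + 1 by ring,
    show (x + 2) / 2 = x / 2 + 1 by ring,
    show (x + 2 - α - 2 * β + 2) / 2 = (x - α - 2 * β + 2) / 2 + 1 by ring,
    show (x + 2 - α + 2) / 2 = (x - α + 2) / 2 + 1 by ring,
    show (x + 2 - 2 * (α + β) + 2) / 2 = (x - 2 * (α + β) + 2) / 2 + 1 by ring,
    show (x + 2 - β + 2) / 2 = (x - β + 2) / 2 + 1 by ring,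
    Complex.Gamma_add_one _ (div_ne_zero h1 two_ne_zero),
    Complex.Gamma_add_one _ (div_ne_zero h2 two_ne_zero),
    Complex.Gamma_add_one _ (div_ne_zero h3 two_ne_zero)]
  simp only [div_eq_mul_inv (_ * _ * _) (_ * _ * _), mul_inv]
  rw [Complex.one_div_Gamma_eq_self_mul_one_div_Gamma_add_one ((x - α + 2) / 2),
    Complex.one_div_Gamma_eq_self_mul_one_div_Gamma_add_one ((x - 2 * (α + β) + 2) / 2),
    Complex.one_div_Gamma_eq_self_mul_one_div_Gamma_add_one ((x - β + 2) / 2)]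
  ring

theorem ne_neg_natCast_of_re_pos {s : ℂ} (hs : 0 < s.re) (k : ℕ) : s ≠ -k := by
  rintro rfl
  simp only [Complex.neg_re, Complex.natCast_re] at hs
  linarith [(Nat.cast_nonneg k : (0 : ℝ) ≤ k)]

theorem re_add_two_div_two_pos {x a : ℂ} (h : ‖a‖ < x.re) : 0 < ((x - a + 2) / 2).re := by
  rw [show (x - a + 2) / 2 = ((1 / 2 : ℝ) : ℂ) * (x - a + 2) by push_cast; ring,
    Complex.re_ofReal_mul]
  simp only [Complex.add_re, Complex.sub_re, Complex.re_ofNat]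
  linarith [Complex.re_le_norm a]

theorem gamma_arguments_re_pos {α β x : ℂ} (h : 4 * ‖α‖ + 4 * ‖β‖ < x.re) :
    0 < ((x - 2 * α - β + 2) / 2).re ∧ 0 < (x / 2).re ∧ 0 < ((x - α - 2 * β + 2) / 2).re ∧
    0 < ((x - α + 2) / 2).re ∧ 0 < ((x - 2 * (α + β) + 2) / 2).re ∧ 0 < ((x - β + 2) / 2).re := by
  have ha := norm_nonneg α
  have hb := norm_nonneg β
  have n1 : ‖2 * α + β‖ ≤ 2 * ‖α‖ + ‖β‖ := by
    simpa using norm_add_le (2 * α) β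
  have n2 : ‖α + 2 * β‖ ≤ ‖α‖ + 2 * ‖β‖ := by
    simpa using norm_add_le α (2 * β)
  have n3 : ‖2 * (α + β)‖ ≤ 2 * (‖α‖ + ‖β‖) := by
    simpa using norm_add_le α β
  refine ⟨?_, ?_, ?_, ?_, ?_, ?_⟩
  · rw [sub_sub]
    exact re_add_two_div_two_pos (by linarith)
  · rw [show x / 2 = ((1 / 2 : ℝ) : ℂ) * x by push_cast; ring, Complex.re_ofReal_mul]
    linarith
  · rw [sub_sub]
    exact re_add_two_div_two_pos (by linarith)
  · exact re_add_two_div_two_pos (by linarith)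
  · exact re_add_two_div_two_pos (by linarith)
  · exact re_add_two_div_two_pos (by linarith)

theorem tendsto_mul_gammaQuotient {α β x : ℂ} (h : 4 * ‖α‖ + 4 * ‖β‖ < x.re) :
    Tendsto (fun n : ℕ => (x + 2 * ((n : ℂ) + 1)) / 2 * gammaQuotient α β (x + 2 * (n + 1)))
      atTop (𝓝 1) := by
  obtain ⟨p1, p2, p3, p4, p5, p6⟩ := gamma_arguments_re_pos h
  set s₁ := (x - 2 * α - β + 2) / 2 with hs1
  set s₂ := x / 2 with hs2
  set s₃ := (x - α - 2 * β + 2) / 2 with hs3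
  set t₁ := (x - α + 2) / 2 with ht1
  set t₂ := (x - 2 * (α + β) + 2) / 2 with ht2
  set t₃ := (x - β + 2) / 2 with ht3
  have T : ∀ {s : ℂ}, 0 < s.re → Tendsto
      (fun n : ℕ => (n : ℂ) ^ s * n.factorial / Complex.Gamma (s + (n + 1))) atTop (𝓝 1) :=
    fun hs => tendsto_cpow_mul_factorial_div_Gamma (ne_neg_natCast_of_re_pos hs)
  have hnum := (((T p4).mul (T p5)).mul (T p6))
  have hden := (((T p1).mul (T p2)).mul (T p3))
  have hlin : Tendsto (fun n : ℕ => 1 + (s₂ + 1) * (n : ℂ)⁻¹) atTop (𝓝 1) := by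
    have := ((tendsto_inv_atTop_nhds_zero_nat (𝕜 := ℂ)).const_mul (s₂ + 1)).const_add 1
    rwa [mul_zero, add_zero] at this
  have hall := (hnum.div hden (by simp)).mul hlin
  simp only [mul_one, div_one] at hall
  refine hall.congr' ?_
  filter_upwards [eventually_ne_atTop 0] with n hn
  have hn' : (n : ℂ) ≠ 0 := by exact_mod_cast hn
  have hf : (n.factorial : ℂ) ≠ 0 := by exact_mod_cast Nat.factorial_ne_zero _
  have hg : ∀ {s : ℂ}, 0 < s.re → Complex.Gamma (s + (n + 1)) ≠ 0 := fun {s} hs =>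
    Complex.Gamma_ne_zero (ne_neg_natCast_of_re_pos (by
      simp only [Complex.add_re, Complex.natCast_re, Complex.one_re]
      positivity))
  have g1 := hg p1
  have g2 := hg p2
  have g3 := hg p3
  have g4 := hg p4
  have g5 := hg p5
  have g6 := hg p6
  -- The three denominator arguments exceed the three numerator arguments by `1` in total, hence `G
  -- ~ 1 / n`, which the linear factor compensates.
  have hpow : (n : ℂ) ^ t₁ * (n : ℂ) ^ t₂ * (n : ℂ) ^ t₃ =
      (n : ℂ) ^ s₁ * (n : ℂ) ^ s₂ * (n : ℂ) ^ s₃ * n := by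
    conv_rhs => arg 2; rw [← Complex.cpow_one (n : ℂ)]
    simp only [← Complex.cpow_add _ _ hn']
    congr 1
    rw [hs1, hs2, hs3, ht1, ht2, ht3]
    ring
  have c1 : (n : ℂ) ^ s₁ ≠ 0 := by simp [Complex.cpow_eq_zero_iff, hn']
  have c2 : (n : ℂ) ^ s₂ ≠ 0 := by simp [Complex.cpow_eq_zero_iff, hn']
  have c3 : (n : ℂ) ^ s₃ ≠ 0 := by simp [Complex.cpow_eq_zero_iff, hn']
  have hG : gammaQuotient α β (x + 2 * (n + 1)) =
      Complex.Gamma (s₁ + (n + 1)) * Complex.Gamma (s₂ + (n + 1)) * Complex.Gamma (s₃ + (n + 1)) /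
      (Complex.Gamma (t₁ + (n + 1)) * Complex.Gamma (t₂ + (n + 1)) *
        Complex.Gamma (t₃ + (n + 1))) := by
    simp only [gammaQuotient, hs1, hs2, hs3, ht1, ht2, ht3]
    congr 1 <;> ring_nf
  have hx2 : (x + 2 * ((n : ℂ) + 1)) / 2 = s₂ + (n + 1) := by rw [hs2]; ring
  rw [hG, hx2]
  simp only [Pi.div_apply]
  have e : (n : ℂ) ^ t₁ * n.factorial / Complex.Gamma (t₁ + (n + 1)) *
      ((n : ℂ) ^ t₂ * n.factorial / Complex.Gamma (t₂ + (n + 1))) *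
      ((n : ℂ) ^ t₃ * n.factorial / Complex.Gamma (t₃ + (n + 1))) =
      (n : ℂ) ^ s₁ * (n : ℂ) ^ s₂ * (n : ℂ) ^ s₃ * n * (n.factorial : ℂ) ^ 3 /
      (Complex.Gamma (t₁ + (n + 1)) * Complex.Gamma (t₂ + (n + 1)) *
        Complex.Gamma (t₃ + (n + 1))) := by
    rw [← hpow]
    field_simp
  rw [e]
  field_simp
  ring

/-! ### Identification of the limit in the half-plane -/

theorem re_add_two_mul_natCast (x : ℂ) (n : ℕ) : (x + 2 * (n : ℂ)).re = x.re + 2 * n := by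
  simp

/-- The growth rates of the numerators and of the denominators. -/
theorem exists_hasGrowth_numerators_denominators {α β x : ℂ} (hz : 0 < (x + 1 - α - β).re) :
    ∃ lA lB : ℂ, HasGrowth (x + 1 - α - β) (solution α β x 0 1) lA ∧
      HasGrowth (x + 1 - α - β) (solution α β x 1 (x / 2)) lB := by
  obtain ⟨lA, hA, -⟩ := (isSol_solution α β x 0 1).exists_hasGrowth hz
  obtain ⟨lB, hB, -⟩ := (isSol_solution α β x 1 (x / 2)).exists_hasGrowth hz
  exact ⟨lA, lB, hA, hB⟩

/-- Relation between the growth rates at `x` and at `x + 2`. -/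
theorem exists_growth_shift {α β x : ℂ} (hz : 0 < (x + 1 - α - β).re) {lA lB lA' lB' : ℂ}
    (hA : HasGrowth (x + 1 - α - β) (solution α β x 0 1) lA)
    (hB : HasGrowth (x + 1 - α - β) (solution α β x 1 (x / 2)) lB)
    (hA' : HasGrowth (x + 2 + 1 - α - β) (solution α β (x + 2) 0 1) lA')
    (hB' : HasGrowth (x + 2 + 1 - α - β) (solution α β (x + 2) 1 ((x + 2) / 2)) lB') :
    ∃ c : ℂ, c ≠ 0 ∧ c * lA = shiftDen α β x * lA' ∧ c * lB = shiftNum α β x * lB' := by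
  refine ⟨16 * (x + 1 - α - β) * ((x + 1 - α - β + 1) * (x + 1 - α - β + 2)), ?_, ?_, ?_⟩
  · set z := x + 1 - α - β
    have h : ∀ t : ℝ, 0 ≤ t → z + t ≠ 0 := fun t ht h0 => by
      have := congrArg Complex.re h0
      rw [Complex.add_re, Complex.ofReal_re, Complex.zero_re] at this
      linarith
    have h0 := h 0 le_rfl
    have h1 := h 1 zero_le_one
    have h2 := h 2 zero_le_two
    push_cast at h0 h1 h2
    rw [add_zero] at h0
    exact mul_ne_zero (mul_ne_zero (by norm_num) h0) (mul_ne_zero h1 h2)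
  · refine (hA.shift hz).unique ?_
    rw [show shiftSol α β x (solution α β x 0 1) = _ from funext (shiftSol_numerators α β x)]
    exact hA'.const_mul _
  · refine (hB.shift hz).unique ?_
    rw [show shiftSol α β x (solution α β x 1 (x / 2)) = _ from
      funext (shiftSol_denominators α β x)]
    exact hB'.const_mul _

/-- Along `x + 2 * n` the quantity `b * G / a` is constant, as growth constants and `G` satisfy the
same equation, and it tends to `1`. -/
theorem exists_growth_eq_gammaQuotient_mul (α β : ℂ) : ∃ R : ℝ, ∀ x : ℂ, R < x.re →
    0 < (x + 1 - α - β).re ∧ ∀ lA lB : ℂ,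
      HasGrowth (x + 1 - α - β) (solution α β x 0 1) lA →
      HasGrowth (x + 1 - α - β) (solution α β x 1 (x / 2)) lB →
      lA = gammaQuotient α β x * lB ∧ lB ≠ 0 := by
  obtain ⟨R, C, hR, h⟩ := exists_growth_quotient_bound α β
  refine ⟨R + (4 * ‖α‖ + 4 * ‖β‖), fun x hx => ?_⟩
  have hab : 0 ≤ 4 * ‖α‖ + 4 * ‖β‖ := by positivity
  have hxR : R < x.re := by linarith
  have hxab : 4 * ‖α‖ + 4 * ‖β‖ < x.re := by linarith
  refine ⟨(h x hxR).1, fun lA lB hA hB => ⟨?_, ((h x hxR).2 lA lB hA hB).2.1⟩⟩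
  set X : ℕ → ℂ := fun n => x + 2 * n with hX
  have hXre : ∀ n, (X n).re = x.re + 2 * n := re_add_two_mul_natCast x
  have hXR : ∀ n, R < (X n).re := fun n => by
    rw [hXre]
    linarith [(Nat.cast_nonneg n : (0 : ℝ) ≤ n)]
  have hXpos : ∀ n, 4 * ‖α‖ + 4 * ‖β‖ < (X n).re := fun n => by
    rw [hXre]
    linarith [(Nat.cast_nonneg n : (0 : ℝ) ≤ n)]
  have hXsucc : ∀ n, X (n + 1) = X n + 2 := fun n => by simp only [hX]; push_cast; ring
  have hX0 : X 0 = x := by simp [hX]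
  choose a b ha hb using fun n => exists_hasGrowth_numerators_denominators (h (X n) (hXR n)).1
  have hne := fun n => (h (X n) (hXR n)).2 (a n) (b n) (ha n) (hb n)
  have hre0 : ∀ {s : ℂ}, 0 < (s / 2).re → s ≠ 0 := fun {s} hs h0 => by simp [h0] at hs
  have hnum : ∀ n, shiftNum α β (X n) ≠ 0 := fun n => by
    obtain ⟨p1, p2, p3, -⟩ := gamma_arguments_re_pos (hXpos n)
    exact mul_ne_zero (mul_ne_zero (hre0 p2) (hre0 p1)) (hre0 p3)
  have hden : ∀ n, shiftDen α β (X n) ≠ 0 := fun n => by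
    obtain ⟨-, -, -, p4, p5, p6⟩ := gamma_arguments_re_pos (hXpos n)
    exact mul_ne_zero (mul_ne_zero (hre0 p4) (hre0 p5)) (hre0 p6)
  have hconst : ∀ n, b n * gammaQuotient α β (X n) / a n = b 0 * gammaQuotient α β (X 0) / a 0 := by
    intro n
    induction n with
    | zero => rfl
    | succ n ih =>
      rw [← ih]
      have hA' := ha (n + 1)
      have hB' := hb (n + 1)
      rw [hXsucc] at hA' hB'
      obtain ⟨c, hc, e1, e2⟩ := exists_growth_shift (h (X n) (hXR n)).1 (ha n) (hb n) hA' hB'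
      have e3 := gammaQuotient_add_two_mul (hnum n)
      rw [hXsucc, div_eq_div_iff (hne _).1 (hne _).1]
      refine mul_left_cancel₀ (mul_ne_zero hc (mul_ne_zero (hden n) (hnum n))) ?_
      linear_combination shiftNum α β (X n) * b (n + 1) * c * a n * e3 +
        shiftNum α β (X n) * b (n + 1) * gammaQuotient α β (X n) * shiftNum α β (X n) * e1 -
        gammaQuotient α β (X n) * a (n + 1) * shiftDen α β (X n) * shiftNum α β (X n) * e2
  have hlim1 : Tendsto (fun n => b n / (X n / 2 * a n)) atTop (𝓝 1) := by
    rw [tendsto_iff_norm_sub_tendsto_zero]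
    refine squeeze_zero (fun n => norm_nonneg _) (fun n => (hne n).2.2) ?_
    have h1 : Tendsto (fun n : ℕ => (X n).re - R) atTop atTop := by
      simp only [hXre]
      refine tendsto_atTop_add_const_right _ (-R) (tendsto_atTop_add_const_left _ _ ?_)
      exact tendsto_natCast_atTop_atTop.const_mul_atTop two_pos
    exact h1.const_div_atTop C
  have hlim2 : Tendsto (fun n => X (n + 1) / 2 * gammaQuotient α β (X (n + 1))) atTop (𝓝 1) := by
    refine (tendsto_mul_gammaQuotient (x := x) hxab).congr fun n => ?_
    simp only [hX]
    push_cast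
    rfl
  have hlim := ((tendsto_add_atTop_iff_nat 1).2 hlim1).mul hlim2
  have hone : b 0 * gammaQuotient α β (X 0) / a 0 = 1 * 1 := by
    refine tendsto_nhds_unique (tendsto_const_nhds.congr fun n => ?_) hlim
    rw [← hconst (n + 1)]
    have hXn : X (n + 1) ≠ 0 := fun h0 => by
      have := hXpos (n + 1)
      rw [h0, Complex.zero_re] at this
      linarith
    have := (hne (n + 1)).1
    field_simp
  have h0A := ha 0
  have h0B := hb 0
  rw [hX0] at h0A h0B hone
  rw [hA.unique h0A, hB.unique h0B]
  rw [mul_one, div_eq_one_iff_eq (hne 0).1] at hone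
  rw [← hone, mul_comm]

/-- Induction on the number of steps of length `2` needed to reach the far half-plane. The
conditions on the numerator Gamma factors keep `shiftNum` nonzero, so `lB ≠ 0` also descends. -/
theorem growth_eq_gammaQuotient_mul {α β x : ℂ} (hz : 0 < (x + 1 - α - β).re)
    (h₁ : ∀ n : ℕ, (x - 2 * α - β + 2) / 2 ≠ -(n : ℂ))
    (h₂ : ∀ n : ℕ, x / 2 ≠ -(n : ℂ))
    (h₃ : ∀ n : ℕ, (x - α - 2 * β + 2) / 2 ≠ -(n : ℂ)) {lA lB : ℂ}
    (hA : HasGrowth (x + 1 - α - β) (solution α β x 0 1) lA)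
    (hB : HasGrowth (x + 1 - α - β) (solution α β x 1 (x / 2)) lB) :
    lA = gammaQuotient α β x * lB ∧ lB ≠ 0 := by
  obtain ⟨R, hR⟩ := exists_growth_eq_gammaQuotient_mul α β
  obtain ⟨N, hN⟩ := exists_nat_gt ((R - x.re) / 2)
  replace hN : R < x.re + 2 * N := by linarith
  induction N generalizing x lA lB with
  | zero => exact (hR x (by simpa using hN)).2 lA lB hA hB
  | succ N ih =>
    have hz' : 0 < (x + 2 + 1 - α - β).re := by
      rw [show x + 2 + 1 - α - β = x + 1 - α - β + 2 by ring, Complex.add_re, Complex.re_ofNat]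
      linarith
    obtain ⟨lA', lB', hA', hB'⟩ := exists_hasGrowth_numerators_denominators hz'
    have hnext : ∀ {s : ℂ}, (∀ n : ℕ, s ≠ -(n : ℂ)) → ∀ n : ℕ, s + 1 ≠ -(n : ℂ) :=
      fun {s} hs n h => hs (n + 1) (by push_cast; linear_combination h)
    obtain ⟨e, hne⟩ := ih hz'
      (fun n h => hnext h₁ n (by linear_combination h))
      (fun n h => hnext h₂ n (by linear_combination h))
      (fun n h => hnext h₃ n (by linear_combination h)) hA' hB' (by
        rw [Complex.add_re, Complex.re_ofNat]
        push_cast at hN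
        linarith)
    obtain ⟨c, hc, e1, e2⟩ := exists_growth_shift hz hA hB hA' hB'
    have hs0 : ∀ {s : ℂ}, (∀ n : ℕ, s / 2 ≠ -(n : ℂ)) → s ≠ 0 := fun {s} hs h0 =>
      hs 0 (by simp [h0])
    have hnum : shiftNum α β x ≠ 0 := mul_ne_zero (mul_ne_zero (hs0 h₂) (hs0 h₁)) (hs0 h₃)
    have e3 := gammaQuotient_add_two_mul hnum
    refine ⟨mul_left_cancel₀ hc ?_, fun h0 => ?_⟩
    · linear_combination e1 + shiftDen α β x * e + lB' * e3 - gammaQuotient α β x * e2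
    · rw [h0, mul_zero] at e2
      exact mul_ne_zero hnum hne e2.symm

/-- Convergence of the quotients of the solutions, in the half-plane. -/
theorem tendsto_solution_div_solution {α β x : ℂ} (hz : 0 < (x + 1 - α - β).re)
    (h₁ : ∀ n : ℕ, (x - 2 * α - β + 2) / 2 ≠ -(n : ℂ))
    (h₂ : ∀ n : ℕ, x / 2 ≠ -(n : ℂ))
    (h₃ : ∀ n : ℕ, (x - α - 2 * β + 2) / 2 ≠ -(n : ℂ)) :
    (∀ᶠ n in atTop, solution α β x 1 (x / 2) n ≠ 0) ∧
      Tendsto (fun n => solution α β x 0 1 n / solution α β x 1 (x / 2) n) atTop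
        (𝓝 (gammaQuotient α β x)) := by
  obtain ⟨lA, lB, hA, hB⟩ := exists_hasGrowth_numerators_denominators hz
  obtain ⟨e, hne⟩ := growth_eq_gammaQuotient_mul hz h₁ h₂ h₃ hA hB
  constructor
  · obtain ⟨k, hk⟩ := eventually_atTop.1 (Tendsto.eventually_ne hB hne)
    refine eventually_atTop.2 ⟨k + 1, fun n hn h0 => ?_⟩
    obtain ⟨m, rfl⟩ : ∃ m, n = m + 1 := ⟨n - 1, by omega⟩
    apply hk m (by omega)
    rw [normalized, h0]
    simp
  · rw [← tendsto_add_atTop_iff_nat 1]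
    have := Tendsto.div hA hB hne
    rw [e, mul_div_cancel_right₀ _ hne] at this
    refine this.congr fun n => ?_
    have h1 := growth_ne_zero hz (n / 2)
    have h3 : (n.factorial : ℂ) ≠ 0 := by exact_mod_cast Nat.factorial_ne_zero _
    simp only [Pi.div_apply, normalized]
    rw [div_div_div_cancel_right₀ h1, div_div_div_cancel_right₀ h3,
      mul_div_mul_right _ _ (pow_ne_zero n two_ne_zero)]

/-! ### Approximants, termination and analytic continuation -/

theorem contFrac_get?_of_ne_zero {a b : ℕ → ℂ} {n : ℕ} (h : ∀ k ≤ n, a k ≠ 0) :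
    (contFrac a b).s.get? n = some ⟨a n, b n⟩ :=
  if_pos h

theorem contFrac_terminatedAt {a b : ℕ → ℂ} {n : ℕ} (h : a n = 0) :
    (contFrac a b).TerminatedAt n :=
  if_neg fun h' => h' n le_rfl h

theorem partNum_ne_zero {α β : ℂ} {n : ℕ} (h : ∀ k < n, kappa α β (k + 1) ≠ 0) :
    ∀ k ≤ n, partNum α β k ≠ 0 := by
  rintro (_ | k) hk
  · exact one_ne_zero
  · exact h k (by omega)

/-- The approximants follow the recurrence only until termination, so agreement at index `n` needs
just `κ 1, …, κ (n - 1)` nonzero; the first vanishing `κ (N + 1)` still permits `n = N + 1`. -/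
theorem contFrac_nums_dens_eq_solution {α β x : ℂ} (n : ℕ)
    (h : ∀ k, k + 1 < n → kappa α β (k + 1) ≠ 0) :
    (contFrac (partNum α β) (partDen α β x)).nums n = solution α β x 0 1 n ∧
      (contFrac (partNum α β) (partDen α β x)).dens n = solution α β x 1 (x / 2) n := by
  induction n using Nat.twoStepInduction with
  | zero => exact ⟨rfl, rfl⟩
  | one =>
    have h0 : (contFrac (partNum α β) (partDen α β x)).s.get? 0 = some ⟨_, _⟩ :=
      contFrac_get?_of_ne_zero (partNum_ne_zero fun k hk => absurd hk (by omega))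
    rw [GenContFract.first_num_eq h0, GenContFract.first_den_eq h0]
    simp [partNum, partDen, lam, contFrac, solution]
  | more n ih ih' =>
    obtain ⟨a0, b0⟩ := ih fun k hk => h k (by omega)
    obtain ⟨a1, b1⟩ := ih' fun k hk => h k (by omega)
    have hn : (contFrac (partNum α β) (partDen α β x)).s.get? (n + 1) = some ⟨_, _⟩ :=
      contFrac_get?_of_ne_zero (partNum_ne_zero fun k hk => h k (by omega))
    rw [GenContFract.nums_recurrence hn a0 a1, GenContFract.dens_recurrence hn b0 b1]
    exact ⟨rfl, rfl⟩

/-- The Casoratian starts at `1` and is multiplied by `-κ (n + 1)` at each step. -/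
theorem solution_wronskian_ne_zero {α β x : ℂ} (n : ℕ)
    (h : ∀ k < n, kappa α β (k + 1) ≠ 0) :
    solution α β x 0 1 (n + 1) * solution α β x 1 (x / 2) n -
      solution α β x 0 1 n * solution α β x 1 (x / 2) (n + 1) ≠ 0 := by
  induction n with
  | zero => simp [solution]
  | succ n ih =>
    have h1 := mul_ne_zero (neg_ne_zero.2 (h n (by omega))) (ih fun k hk => h k (by omega))
    convert h1 using 1
    rw [isSol_solution α β x 0 1 n, isSol_solution α β x 1 (x / 2) n]
    ring

/-- Once `κ (n + 1) = 0`, a solution is determined from `n + 1` on by its single value there, so any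
two are proportional. -/
theorem IsSol.mul_eq_mul_of_kappa_eq_zero {α β x : ℂ} {y y' : ℕ → ℂ} (hy : IsSol α β x y)
    (hy' : IsSol α β x y') {n : ℕ} (h : kappa α β (n + 1) = 0) (k : ℕ) :
    y (n + 1 + k) * y' (n + 1) = y' (n + 1 + k) * y (n + 1) := by
  induction k using Nat.twoStepInduction with
  | zero => ring_nf
  | one =>
    rw [show n + 1 + 1 = n + 2 by ring, hy n, hy' n, h]
    ring
  | more k ih ih' =>
    rw [show n + 1 + (k + 2) = n + 1 + k + 2 by ring, hy (n + 1 + k), hy' (n + 1 + k)]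
    rw [← add_assoc] at ih'
    linear_combination (x + lam α β (n + 1 + k + 1)) * ih' + kappa α β (n + 1 + k + 1) * ih

theorem differentiable_solution (α β : ℂ) {y₀ y₁ : ℂ → ℂ} (h₀ : Differentiable ℂ y₀)
    (h₁ : Differentiable ℂ y₁) (n : ℕ) :
    Differentiable ℂ fun x => solution α β x (y₀ x) (y₁ x) n := by
  induction n using Nat.twoStepInduction with
  | zero => simpa only [solution] using h₀
  | one => simpa only [solution] using h₁
  | more n ih ih' =>
    simp only [solution]
    fun_prop

/-- A terminating continued fraction equals its value in the half-plane, hence everywhere. -/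
theorem mul_gammaQuotient_eq_of_kappa_eq_zero {α β x : ℂ}
    (h₁ : ∀ n : ℕ, (x - 2 * α - β + 2) / 2 ≠ -(n : ℂ))
    (h₂ : ∀ n : ℕ, x / 2 ≠ -(n : ℂ))
    (h₃ : ∀ n : ℕ, (x - α - 2 * β + 2) / 2 ≠ -(n : ℂ)) {n : ℕ} (h : kappa α β (n + 1) = 0) :
    solution α β x 1 (x / 2) (n + 1) * gammaQuotient α β x = solution α β x 0 1 (n + 1) := by
  -- Far to the right the approximants are eventually constant, hence equal to their limit; the form
  -- without division avoids assuming the last denominator nonzero.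
  have hhalf : ∀ t : ℂ, 0 < (t + 1 - α - β).re → 4 * ‖α‖ + 4 * ‖β‖ < t.re →
      solution α β t 1 (t / 2) (n + 1) * gammaQuotient α β t = solution α β t 0 1 (n + 1) := by
    intro t ht htab
    obtain ⟨p1, p2, p3, -⟩ := gamma_arguments_re_pos htab
    obtain ⟨hB, hlim⟩ := tendsto_solution_div_solution ht (ne_neg_natCast_of_re_pos p1)
      (ne_neg_natCast_of_re_pos p2) (ne_neg_natCast_of_re_pos p3)
    refine tendsto_nhds_unique (hlim.const_mul _) (tendsto_const_nhds.congr' ?_)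
    filter_upwards [hB, eventually_ge_atTop (n + 1)] with m hm hmn
    obtain ⟨k, rfl⟩ := Nat.exists_eq_add_of_le hmn
    have := (isSol_solution α β t 0 1).mul_eq_mul_of_kappa_eq_zero
      (isSol_solution α β t 1 (t / 2)) h k
    field_simp
    linear_combination -this
  -- Multiplied out with the entire function `1 / Γ`, the identity becomes `E = 0` with `E` entire,
  -- so validity on an open half-plane suffices.
  set E : ℂ → ℂ := fun t => solution α β t 0 1 (n + 1) *
      ((Complex.Gamma ((t - 2 * α - β + 2) / 2))⁻¹ * (Complex.Gamma (t / 2))⁻¹ *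
        (Complex.Gamma ((t - α - 2 * β + 2) / 2))⁻¹) -
      solution α β t 1 (t / 2) (n + 1) *
      ((Complex.Gamma ((t - α + 2) / 2))⁻¹ * (Complex.Gamma ((t - 2 * (α + β) + 2) / 2))⁻¹ *
        (Complex.Gamma ((t - β + 2) / 2))⁻¹) with hE
  have hEd : Differentiable ℂ E := by
    have hA := differentiable_solution α β (y₀ := fun _ => 0) (y₁ := fun _ => 1) (by fun_prop)
      (by fun_prop) (n + 1)
    have hB := differentiable_solution α β (y₀ := fun _ => 1) (y₁ := fun t => t / 2) (by fun_prop)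
      (by fun_prop) (n + 1)
    have hG : ∀ {f : ℂ → ℂ}, Differentiable ℂ f →
        Differentiable ℂ fun t => (Complex.Gamma (f t))⁻¹ := fun hf =>
      Complex.differentiable_one_div_Gamma.comp hf
    exact (hA.mul (((hG (by fun_prop)).mul (hG (by fun_prop))).mul (hG (by fun_prop)))).sub
      (hB.mul (((hG (by fun_prop)).mul (hG (by fun_prop))).mul (hG (by fun_prop))))
  have hE0 : E = 0 := by
    have hab := norm_nonneg α
    have hbb := norm_nonneg β
    set r : ℝ := 4 * ‖α‖ + 4 * ‖β‖ with hr
    refine AnalyticOnNhd.eq_of_eventuallyEq (z₀ := ((r + 1 : ℝ) : ℂ))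
      (fun t _ => hEd.analyticAt t) (fun t _ => analyticAt_const) ?_
    have hopen : IsOpen {t : ℂ | r < t.re} := isOpen_lt continuous_const Complex.continuous_re
    filter_upwards [hopen.mem_nhds (show ((r + 1 : ℝ) : ℂ) ∈ {t : ℂ | r < t.re} by simp)] with t ht
    have ht' : r < t.re := ht
    obtain ⟨p1, p2, p3, -⟩ := gamma_arguments_re_pos ht'
    have g1 := Complex.Gamma_ne_zero_of_re_pos p1
    have g2 := Complex.Gamma_ne_zero_of_re_pos p2
    have g3 := Complex.Gamma_ne_zero_of_re_pos p3
    have hh := hhalf t (by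
      simp only [Complex.sub_re, Complex.add_re, Complex.one_re]
      have := Complex.re_le_norm α
      have := Complex.re_le_norm β
      linarith) ht'
    simp only [hE, ← hh, gammaQuotient, Pi.zero_apply, div_eq_mul_inv (_ * _ * _) (_ * _ * _),
      mul_inv]
    field_simp
    ring
  have hx := congrFun hE0 x
  simp only [hE, Pi.zero_apply] at hx
  have g1 := Complex.Gamma_ne_zero h₁
  have g2 := Complex.Gamma_ne_zero h₂
  have g3 := Complex.Gamma_ne_zero h₃
  rw [sub_eq_zero] at hx
  simp only [gammaQuotient, div_eq_mul_inv (_ * _ * _) (_ * _ * _), mul_inv]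
  calc _ = Complex.Gamma ((x - 2 * α - β + 2) / 2) * Complex.Gamma (x / 2) *
        Complex.Gamma ((x - α - 2 * β + 2) / 2) * (solution α β x 1 (x / 2) (n + 1) *
      ((Complex.Gamma ((x - α + 2) / 2))⁻¹ * (Complex.Gamma ((x - 2 * (α + β) + 2) / 2))⁻¹ *
        (Complex.Gamma ((x - β + 2) / 2))⁻¹)) := by ring
    _ = _ := by
      rw [← hx]
      field_simp

/-- A positive even integer `2 * k` kills the even-indexed `κ (2 * k)`; a nonpositive one kills the
odd-indexed `κ (1 - 2 * k)`. -/
theorem exists_kappa_eq_zero {α β : ℂ} {k : ℤ}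
    (h : α = 2 * (k : ℂ) ∨ β = 2 * (k : ℂ) ∨ α + β = 2 * (k : ℂ)) :
    ∃ n : ℕ, kappa α β (n + 1) = 0 := by
  rcases lt_or_ge 0 k with hk | hk
  · obtain ⟨m, rfl⟩ : ∃ m : ℕ, k = m + 1 := ⟨(k - 1).toNat, by omega⟩
    refine ⟨2 * m + 1, ?_⟩
    rw [show 2 * m + 1 + 1 = 2 * (m + 1) by ring, kappa_two_mul, div_eq_zero_iff]
    left
    push_cast at h ⊢
    rcases h with h | h | h
    · rw [h]; ring
    · rw [h]; ring
    · rw [sub_sub, h]; ring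
  · obtain ⟨m, rfl⟩ : ∃ m : ℕ, k = -m := ⟨(-k).toNat, by omega⟩
    refine ⟨2 * m, ?_⟩
    rw [kappa_odd, div_eq_zero_iff]
    left
    push_cast at h
    rcases h with h | h | h
    · rw [h]; ring
    · rw [h]; ring
    · rw [add_assoc, h]; ring

end

theorem theorem4 (α β x : ℂ)
    (hx : (α + β - 1).re < x.re ∨
      ∃ k : ℤ, α = 2 * (k : ℂ) ∨ β = 2 * (k : ℂ) ∨ α + β = 2 * (k : ℂ))
    (h₁ : ∀ n : ℕ, (x - 2 * α - β + 2) / 2 ≠ -(n : ℂ))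
    (h₂ : ∀ n : ℕ, x / 2 ≠ -(n : ℂ))
    (h₃ : ∀ n : ℕ, (x - α - 2 * β + 2) / 2 ≠ -(n : ℂ)) :
    ConvergesTo (contFrac (partNum α β) (partDen α β x))
      (Complex.Gamma ((x - 2 * α - β + 2) / 2) * Complex.Gamma (x / 2) *
          Complex.Gamma ((x - α - 2 * β + 2) / 2) /
        (Complex.Gamma ((x - α + 2) / 2) * Complex.Gamma ((x - 2 * (α + β) + 2) / 2) *
          Complex.Gamma ((x - β + 2) / 2))) := by
  change ConvergesTo _ (gammaQuotient α β x)
  -- The split is on termination and not on `hx`: the even-integer alternative always terminates, so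
  -- without termination the half-plane condition must hold.
  by_cases hκ : ∃ n : ℕ, kappa α β (n + 1) = 0
  · classical
    set N := Nat.find hκ with hN
    have hN0 : kappa α β (N + 1) = 0 := Nat.find_spec hκ
    have hlt : ∀ k < N, kappa α β (k + 1) ≠ 0 := fun k hk => Nat.find_min hκ hk
    obtain ⟨eA, eB⟩ := contFrac_nums_dens_eq_solution (x := x) (N + 1)
      (fun k hk => hlt k (by omega))
    have hterm : (contFrac (partNum α β) (partDen α β x)).TerminatedAt (N + 1) :=
      contFrac_terminatedAt hN0
    have hval := mul_gammaQuotient_eq_of_kappa_eq_zero h₁ h₂ h₃ hN0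
    -- By `hval`, a zero last denominator would make the last numerator vanish too, contradicting
    -- the nonzero Casoratian.
    have hB : solution α β x 1 (x / 2) (N + 1) ≠ 0 := fun h0 => by
      have hw := solution_wronskian_ne_zero (x := x) N hlt
      rw [← hval, h0] at hw
      simp at hw
    constructor
    · filter_upwards [eventually_ge_atTop (N + 1)] with m hm
      rwa [GenContFract.dens_stable_of_terminated hm hterm, eB]
    · refine tendsto_const_nhds.congr' ?_
      filter_upwards [eventually_ge_atTop (N + 1)] with m hm
      rw [GenContFract.convs_stable_of_terminated hm hterm, GenContFract.conv_eq_num_div_den, eA, eB,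
        eq_div_iff hB, mul_comm, hval]
  · push Not at hκ
    have hz : 0 < (x + 1 - α - β).re := by
      rcases hx with hx | ⟨k, hk⟩
      · simp only [Complex.sub_re, Complex.add_re, Complex.one_re] at hx ⊢
        linarith
      · obtain ⟨n, hn⟩ := exists_kappa_eq_zero hk
        exact absurd hn (hκ n)
    have e := fun n => contFrac_nums_dens_eq_solution (x := x) n (fun k _ => hκ k)
    obtain ⟨hB, hlim⟩ := tendsto_solution_div_solution hz h₁ h₂ h₃
    constructor
    · filter_upwards [hB] with n hn
      rwa [(e n).2]
    · refine hlim.congr fun n => ?_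
      rw [GenContFract.conv_eq_num_div_den, (e n).1, (e n).2]
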